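/- Fix integers $K\ge 2$ and $L>T\ge 1$ and reals $\rho\in(1/3,1)$, $c>0$, $\delta>0$, $\eta_{\max}>0$. There is a sequence $\mathrm{err}(n)\to 0$, depending only on these constants, such that the following holds. Let $n\ge 1$, let $V=\{1,\dots,n\}$ be partitioned into $K$ communities $V_1,\dots,V_K$ of size $n/K$, let $p,q\in[0,1]$ with $q\ge n^{\rho-1}$ and $p\ge(1+\delta)q$, and let $0<\eta\le\eta_{\max}$. Draw a simple graph $G$ on $V$ from the symmetric stochastic block model: pairs $i<j$ are joined independently, with probability $p$ if $i,j$ lie in the same community and $q$ otherwise. For a nonnegative symmetric matrix $A$ write $D_A=\mathrm{diag}(A\mathbf 1)$, $P_A=D_A^{-1}A$ and $$\mathcal C(A)=2\sum_{t=1}^{T}\frac{L-t}{\mathbf 1^\top A\mathbf 1}\,D_AP_A^{t}.$$ Let $C=\mathcal C(A)$ be the co-occurrence matrix of $G$ ($A$ its adjacency matrix, so $\mathbf 1^\top A\mathbf 1=2|E|$; walks of length $L$, window size $T$, number of walks tending to infinity), and let $\overline C=\mathcal C(\overline A)$, where $\overline A_{ij}=p$ if $i,j$ are in the same community (including $i=j$)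 and $\overline A_{ij}=q$ otherwise. Let $\gamma=\frac{n(a-b)}{2K}=\frac1n\sum_{t=1}^T(L-t)\bigl(\tfrac{p-q}{p+(K-1)q}\bigr)^t$, where $a$ and $b$ are the entries of $\overline C$ inside and outside the diagonal blocks. Run one-dimensional DeepWalk gradient descent on $C$ with learning rate $\eta$, $\epsilon=n^{-2/3}$ and $\Delta=n^{1/6}$: draw $g\in\mathbb R^{2n}$ with independent standard Gaussian entries, put $w^{(0)}=\epsilon g/\|g\|$, and with $w^{(t)}=(x^{(t)},y^{(t)})$, $Q^{(t)}_{ij}=e^{x^{(t)}_iy^{(t)}_j}/\sum_k e^{x^{(t)}_iy^{(t)}_k}$ and $G^{(t)}=D_CQ^{(t)}-C$ iterate $$x^{(t+1)}=x^{(t)}-\eta G^{(t)}y^{(t)},\qquad y^{(t+1)}=y^{(t)}-\eta (G^{(t)})^{\top}x^{(t)},$$ stopping at the first $t_f\ge1$ with $\|w^{(t_f)}\|\ge\epsilon\Delta$. Then for almost every $G$ for which $R=C-\overline C$ is symmetric with spectral norm $\|R\|<c/\sqrt{n^{\rho+2}}$, with probability at least $1-\mathrm{err}(n)$ over the initialization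 the algorithm stops after $t_f<\frac{4\log(n/\Delta)}{\eta\gamma}$ iterations and $x=x^{(t_f)}$ recovers at least a $1-\mathrm{err}(n)$ fraction of every community, where $j\in V_i$ is called recovered if $|x_j-\mu_i|<\frac12\min_{k\ne l}|\mu_k-\mu_l|$, with $\mu_k$ the mean of $x$ over $V_k$. -/

import Mathlib

open MeasureTheory ProbabilityTheory Filter Topology

noncomputable section

namespace DeepWalk

/-! ### The symmetric stochastic block model -/

/-- `σ` splits the `n` vertices into `K` communities `{i | σ i = k}`, each of size `n / K`. -/
def Balanced {n K : ℕ} (σ : Fin n → Fin K) : Prop :=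
  ∀ k, K * (Finset.univ.filter fun i => σ i = k).card = n

/-- The probability of an edge between `i` and `j`: `p` inside a community, `q` across. -/
def edgeProb {n K : ℕ} (σ : Fin n → Fin K) (p q : unitInterval) (i j : Fin n) : unitInterval :=
  if σ i = σ j then p else q

/-- The pairs `i < j` of vertices. -/
abbrev Pair (n : ℕ) : Type := {e : Fin n × Fin n // e.1 < e.2}

/-- The law of the edge indicators of the symmetric SBM: one independent Bernoulli variable for
each pair `i < j`. -/
def sbm {n K : ℕ} (σ : Fin n → Fin K) (p q : unitInterval) : Measure (Pair n → Bool) :=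
  Measure.pi fun e => bernoulliMeasure true false (edgeProb σ p q e.1.1 e.1.2)

/-- The simple graph with the given edge indicators. -/
def graphOf {n : ℕ} (e : Pair n → Bool) : SimpleGraph (Fin n) :=
  SimpleGraph.fromRel fun i j => ∃ h : i < j, e ⟨(i, j), h⟩ = true

open Classical in
/-- The adjacency matrix of a graph. -/
def adj {n : ℕ} (G : SimpleGraph (Fin n)) : Matrix (Fin n) (Fin n) ℝ :=
  G.adjMatrix ℝ

/-- The expected adjacency matrix `B ⊗ J` (up to the order of the vertices): `p` on the diagonal
blocks, diagonal included, and `q` off them. -/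
def expAdj {n K : ℕ} (σ : Fin n → Fin K) (p q : unitInterval) : Matrix (Fin n) (Fin n) ℝ :=
  Matrix.of fun i j => (edgeProb σ p q i j : ℝ)

/-! ### The co-occurrence matrix -/

/-- The degree `d_i`, the `i`-th row sum. -/
def deg {n : ℕ} (A : Matrix (Fin n) (Fin n) ℝ) (i : Fin n) : ℝ := ∑ j, A i j

/-- The degree operator `D(A) = diag(A 𝟏)`. -/
def degMat {n : ℕ} (A : Matrix (Fin n) (Fin n) ℝ) : Matrix (Fin n) (Fin n) ℝ :=
  Matrix.diagonal (deg A)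

/-- The transition matrix `P = D_A⁻¹ A`. -/
def trans {n : ℕ} (A : Matrix (Fin n) (Fin n) ℝ) : Matrix (Fin n) (Fin n) ℝ :=
  Matrix.diagonal (fun i => (deg A i)⁻¹) * A

/-- The (limiting) co-occurrence matrix of walks of length `L` with window size `T`,
`C = 2 ∑_{t=1}^T (L - t) / vol(A) • D_A P^t`, that is `C_ij = 2 ∑_t (L - t) π_i (P^t)_ij` with
`π_i = d_i / vol(A)`. Here `vol(A) = ∑ d_i`, which is `2|E|` for the adjacency matrix of a graph
and `n d̄`, `d̄ = (n / K) p + (n (K - 1) / K) q`, for the expected adjacency matrix. -/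
def cooc {n : ℕ} (T L : ℕ) (A : Matrix (Fin n) (Fin n) ℝ) : Matrix (Fin n) (Fin n) ℝ :=
  ∑ t ∈ Finset.Icc 1 T, (2 * ((L : ℝ) - t) / ∑ i, deg A i) • (degMat A * trans A ^ t)

/-- The spectral norm. -/
def specNorm {n : ℕ} (A : Matrix (Fin n) (Fin n) ℝ) : ℝ :=
  ‖Matrix.toEuclideanCLM (𝕜 := ℝ) (n := Fin n) A‖

/-- `C = C̄ + R` with `R` symmetric and `‖R‖ < c / √(n^(ρ+2))`. -/
def CoocError {n : ℕ} (ρ c : ℝ) (C Cbar : Matrix (Fin n) (Fin n) ℝ) : Prop :=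
  (C - Cbar).IsSymm ∧ specNorm (C - Cbar) < c / √((n : ℝ) ^ (ρ + 2))

/-- The difference `a - b` between the entries of `C̄` on and off the diagonal blocks. -/
def blockGap (n K T L : ℕ) (p q : ℝ) : ℝ :=
  2 * K / (n : ℝ) ^ 2 *
    ∑ t ∈ Finset.Icc 1 T, ((L : ℝ) - t) * ((p - q) / (p + ((K : ℝ) - 1) * q)) ^ t

/-- `γ = n (a - b) / (2 K)`, half the eigenvalue of `C̄` on the community directions. -/
def gam (n K T L : ℕ) (p q : ℝ) : ℝ :=
  n * blockGap n K T L p q / (2 * K)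

/-! ### One-dimensional DeepWalk gradient descent -/

/-- Stacked embeddings `w = (x, y)`; `x` is the left and `y` the right half. -/
abbrev Emb (n : ℕ) : Type := Fin n ⊕ Fin n → ℝ

/-- The Euclidean norm of `w`. -/
def l2 {n : ℕ} (w : Emb n) : ℝ := √(∑ i, w i ^ 2)

/-- The softmax matrix `Q`. -/
def softmax {n : ℕ} (w : Emb n) : Matrix (Fin n) (Fin n) ℝ :=
  Matrix.of fun i j => Real.exp (w (.inl i) * w (.inr j)) /
    ∑ k, Real.exp (w (.inl i) * w (.inr k))

/-- `G = D_C Q - C`. -/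
def gradMat {n : ℕ} (C : Matrix (Fin n) (Fin n) ℝ) (w : Emb n) : Matrix (Fin n) (Fin n) ℝ :=
  degMat C * softmax w - C

/-- One gradient step, `w ↦ [I, -η G; -η Gᵀ, I] w`. -/
def step {n : ℕ} (C : Matrix (Fin n) (Fin n) ℝ) (η : ℝ) (w : Emb n) : Emb n :=
  (Matrix.fromBlocks 1 (-η • gradMat C w) (-η • (gradMat C w).transpose) 1).mulVec w

/-- `ε = n^(-2/3)`. -/
def eps (n : ℕ) : ℝ := (n : ℝ) ^ (-(2 / 3) : ℝ)

/-- `Δ = n^(1/6)`. -/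
def Del (n : ℕ) : ℝ := (n : ℝ) ^ (1 / 6 : ℝ)

/-- The law of the unnormalized initialization: `2 n` independent standard Gaussians. -/
def gaussInit (n : ℕ) : Measure (Emb n) :=
  Measure.pi fun _ => gaussianReal 0 1

/-- The iterate `w^(t)`, started from the normalization to length `ε` of the vector `g`. -/
def iter {n : ℕ} (C : Matrix (Fin n) (Fin n) ℝ) (η : ℝ) (g : Emb n) (t : ℕ) : Emb n :=
  (step C η)^[t] ((eps n / l2 g) • g)

/-- The algorithm (`repeat … until ‖w^(t)‖ ≥ ε Δ`) stops after exactly `t` iterations. -/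
def StopsAt {n : ℕ} (C : Matrix (Fin n) (Fin n) ℝ) (η : ℝ) (g : Emb n) (t : ℕ) : Prop :=
  IsLeast {s : ℕ | 1 ≤ s ∧ eps n * Del n ≤ l2 (iter C η g s)} t

/-! ### Recovery -/

/-- The mean `μ_k` of the `x`-embedding over community `k`. -/
def clusterMean {n K : ℕ} (σ : Fin n → Fin K) (w : Emb n) (k : Fin K) : ℝ :=
  (∑ i with σ i = k, w (.inl i)) / (Finset.univ.filter fun i => σ i = k).card

/-- Vertex `j` is recovered: its `x`-embedding is closer to the mean of its community than half
the distance between any two community means. -/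
def Recovered {n K : ℕ} (σ : Fin n → Fin K) (w : Emb n) (j : Fin n) : Prop :=
  ∀ k l, k ≠ l →
    |w (.inl j) - clusterMean σ w (σ j)| < |clusterMean σ w k - clusterMean σ w l| / 2

open Classical in
/-- At least a fraction `1 - δ` of every community is recovered. -/
def RecoversFraction {n K : ℕ} (σ : Fin n → Fin K) (w : Emb n) (δ : ℝ) : Prop :=
  ∀ k, (1 - δ) * (Finset.univ.filter fun j => σ j = k).card ≤
    ((Finset.univ.filter fun j => σ j = k ∧ Recovered σ w j).card : ℝ)

end DeepWalk

end

/-! In stacked form one gradient step is `w ↦ w + η (H w + N w)`. Here `H` is `offDiag (C * (1 -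
avgMat n))`, and `N`, which is cubic in `‖w‖`, collects the deviation of the softmax from uniform
weights. The expected matrix is a multiple of `J/n` plus `2γ Π`, with `Π` the projection onto
mean-zero vectors constant on communities. The factor `1 - J/n` kills the first term, so `H` is
within `‖R‖` of `2γ B`, where `B (x, y) = (Π y, Π x)`. For `v` in the range of `Π`, `B` fixes `(v,
v)` and negates `(v, -v)`; it vanishes on the orthogonal complement of these vectors.

Since `‖R‖ / γ = O(n^(-1/6))`, the eigenvalues of `H` cluster at `2γ`, `0` and `-2γ`. The spectral
projection `S` of the top cluster nearly fixes the vectors `(v, v)` and nearly kills the other two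
eigenspaces of `B` (`exists_spectral_split`).

Gradient descent therefore acts as a power iteration. The part `S w` grows like `(1 + 2ηγ)^t` almost
without turning (`signal_bound`), while the rest stays below `2ε` (`noise_bound`). Over a time of
order `log n / (ηγ)` the accumulated effect of `R` and `N` is negligible, yet the signal reaches `ε
Δ` (`exists_horizon`).

At the stopping time `w` equals `S w` up to a relative error `O(1/Δ)`. A Gaussian start has a
component along every difference of community indicators, so the means separate
(`separation_bound`). The deviation from the means lies in the kernel of `B`, so it is small
(`deviation_bound`), and counting as in Chebyshev's inequality leaves few unrecovered vertices. The
only failures are three kinds of Gaussian events, each of probability `O(n^(-1/36))` (`failure_le`).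
-/

noncomputable section

namespace DeepWalk

/-! ### Spectral perturbation of a symmetric operator `2γ B` with `B³ = B`. -/

section Spectral

variable {E : Type*} [NormedAddCommGroup E] [InnerProductSpace ℝ E]

/-- The orthogonal projection onto the span of the basis vectors with index in `I`. -/
def coordProj {ι : Type*} [Fintype ι] (b : OrthonormalBasis ι ℝ E) (I : Finset ι) : E →ₗ[ℝ] E :=
  ∑ i ∈ I, (innerₛₗ ℝ (b i)).smulRight (b i)

variable {ι : Type*} [Fintype ι] (b : OrthonormalBasis ι ℝ E) (I : Finset ι)

theorem coordProj_apply (u : E) : coordProj b I u = ∑ i ∈ I, inner ℝ (b i) u • b i := by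
  simp [coordProj]

theorem inner_coordProj [DecidableEq ι] (u : E) (i : ι) :
    inner ℝ (b i) (coordProj b I u) = if i ∈ I then inner ℝ (b i) u else 0 := by
  rw [coordProj_apply, inner_sum]
  simp_rw [real_inner_smul_right, b.inner_eq_ite]
  simp

theorem norm_sq_eq_sum_inner (u : E) : ‖u‖ ^ 2 = ∑ i, inner ℝ (b i) u ^ 2 := by
  rw [← b.sum_sq_norm_inner_right u]
  simp

theorem norm_sq_coordProj (u : E) : ‖coordProj b I u‖ ^ 2 = ∑ i ∈ I, inner ℝ (b i) u ^ 2 := by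
  classical
  rw [norm_sq_eq_sum_inner b, ← Finset.sum_subset (Finset.subset_univ I)]
  · exact Finset.sum_congr rfl fun i hi => by rw [inner_coordProj, if_pos hi]
  · intro i _ hi
    rw [inner_coordProj, if_neg hi]; simp

theorem norm_sq_sub_coordProj [DecidableEq ι] (u : E) :
    ‖u - coordProj b I u‖ ^ 2 = ∑ i ∈ Iᶜ, inner ℝ (b i) u ^ 2 := by
  rw [norm_sq_eq_sum_inner b, ← Finset.sum_subset (Finset.subset_univ Iᶜ)]
  · refine Finset.sum_congr rfl fun i hi => ?_
    rw [inner_sub_right, inner_coordProj, if_neg (Finset.mem_compl.1 hi), sub_zero]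
  · intro i _ hi
    rw [inner_sub_right, inner_coordProj, if_pos (by simpa using hi)]; simp

theorem ext_inner_basis {u v : E} (h : ∀ i, inner ℝ (b i) u = inner ℝ (b i) v) : u = v :=
  InnerProductSpace.ext_inner_left_basis b.toBasis (by simpa using h)

theorem coordProj_isSymmetric : (coordProj b I).IsSymmetric := by
  intro u v
  rw [coordProj_apply, coordProj_apply, inner_sum, sum_inner]
  refine Finset.sum_congr rfl fun i _ => ?_
  rw [real_inner_smul_left, real_inner_smul_right, real_inner_comm u (b i)]
  ring

theorem coordProj_idem (u : E) : coordProj b I (coordProj b I u) = coordProj b I u := by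
  classical
  refine ext_inner_basis b fun i => ?_
  rw [inner_coordProj, inner_coordProj]
  split_ifs <;> rfl

section Eigen

variable {b} {H : E →ₗ[ℝ] E} {ev : ι → ℝ}

theorem inner_eigen (hH : H.IsSymmetric) (hb : ∀ i, H (b i) = ev i • b i) (u : E) (i : ι) :
    inner ℝ (b i) (H u) = ev i * inner ℝ (b i) u := by
  rw [← hH, hb, real_inner_smul_left]

theorem coordProj_comm (hH : H.IsSymmetric) (hb : ∀ i, H (b i) = ev i • b i) (u : E) :
    coordProj b I (H u) = H (coordProj b I u) := by
  classical
  refine ext_inner_basis b fun i => ?_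
  rw [inner_coordProj, inner_eigen hH hb, inner_eigen hH hb, inner_coordProj]
  split_ifs <;> simp

/-- An approximate eigenvector has small coordinates along the eigenvectors whose eigenvalues are
far away. -/
theorem sum_inner_sq_le_of_approx (hH : H.IsSymmetric) (hb : ∀ i, H (b i) = ev i • b i)
    {θ φ γ : ℝ} (hγ : 0 < γ) {u : E} (hu : ‖H u - θ • u‖ ≤ φ * ‖u‖)
    (hI : ∀ i ∈ I, γ ≤ |ev i - θ|) :
    ∑ i ∈ I, inner ℝ (b i) u ^ 2 ≤ (φ / γ * ‖u‖) ^ 2 := by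
  have h1 : ∑ i ∈ I, γ ^ 2 * inner ℝ (b i) u ^ 2 ≤ ‖H u - θ • u‖ ^ 2 := by
    rw [norm_sq_eq_sum_inner b (H u - θ • u)]
    refine (Finset.sum_le_sum fun i hi => ?_).trans
      (Finset.sum_le_sum_of_subset_of_nonneg (Finset.subset_univ I) fun i _ _ => sq_nonneg _)
    rw [inner_sub_right, inner_eigen hH hb, real_inner_smul_right, ← sub_mul, mul_pow]
    refine mul_le_mul_of_nonneg_right ?_ (sq_nonneg _)
    rw [← sq_abs (ev i - θ)]
    exact pow_le_pow_left₀ hγ.le (hI i hi) 2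
  rw [← Finset.mul_sum] at h1
  have h2 : ‖H u - θ • u‖ ^ 2 ≤ (φ * ‖u‖) ^ 2 := pow_le_pow_left₀ (norm_nonneg _) hu 2
  rw [div_mul_eq_mul_div, div_pow, le_div_iff₀ (by positivity)]
  linarith

end Eigen

section Localize

variable {B : E →ₗ[ℝ] E}

/-- When `B³ = B`, the quantities `(⟨v, B²v⟩ ± ⟨v, Bv⟩) / 2` and `‖v‖² - ⟨v, B²v⟩` are the squared
lengths of the components of `v` in the eigenspaces `±1` and `0`. The identity is then a weighted
sum of squared distances from `x` to `±2γ` and `0`, written without splitting the space. -/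
theorem tripotent_estimate (hB : B.IsSymmetric) (γ x : ℝ) (v : E) :
    ‖x • v - (2 * γ) • B v‖ ^ 2 =
      (x ^ 2 + 4 * γ ^ 2) * inner ℝ v (B (B v)) - 4 * γ * x * inner ℝ v (B v) +
        x ^ 2 * (‖v‖ ^ 2 - inner ℝ v (B (B v))) := by
  have h : inner ℝ (B v) (B v) = inner ℝ v (B (B v)) := hB v (B v)
  rw [norm_sub_sq_real, norm_smul, norm_smul, mul_pow, mul_pow, ← real_inner_self_eq_norm_sq (B v),
    h, real_inner_smul_left, real_inner_smul_right, Real.norm_eq_abs, Real.norm_eq_abs, sq_abs,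
    sq_abs]
  ring

/-- This says that the three weights are nonnegative: expand `‖Bv ± B²v‖²` and `‖v - B²v‖²`. -/
theorem tripotent_nonneg (hB : B.IsSymmetric) (hB3 : ∀ v, B (B (B v)) = B v) (v : E) :
    |inner ℝ v (B v)| ≤ inner ℝ v (B (B v)) ∧ inner ℝ v (B (B v)) ≤ ‖v‖ ^ 2 := by
  have e2 : inner ℝ (B v) (B v) = inner ℝ v (B (B v)) := hB v (B v)
  have e3 : inner ℝ (B v) (B (B v)) = inner ℝ v (B v) := by rw [hB, hB3]
  have e4 : inner ℝ (B (B v)) (B (B v)) = inner ℝ v (B (B v)) := by rw [hB, hB3, e2]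
  have h1 : 0 ≤ ‖B v + B (B v)‖ ^ 2 := by positivity
  have h2 : 0 ≤ ‖B v - B (B v)‖ ^ 2 := by positivity
  have h3 : 0 ≤ ‖v - B (B v)‖ ^ 2 := by positivity
  rw [norm_add_sq_real] at h1
  rw [norm_sub_sq_real] at h2 h3
  simp only [← real_inner_self_eq_norm_sq] at h1 h2 h3 ⊢
  rw [e2, e3, e4] at h1 h2
  rw [e4] at h3
  exact ⟨abs_le.2 ⟨by linarith, by linarith⟩, by linarith⟩

end Localize

variable [FiniteDimensional ℝ E]

/-- The spectral splitting of a perturbation `H` of `2γ B`, `B³ = B`: `S` projects onto the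
eigenvectors of `H` that belong to eigenvalues near `2γ`. -/
theorem exists_spectral_split {H B : E →ₗ[ℝ] E} (hH : H.IsSymmetric) (hB : B.IsSymmetric)
    (hB3 : ∀ v, B (B (B v)) = B v) {γ φ : ℝ} (hγ : 0 < γ) (hφ : 0 ≤ φ) (hφγ : 2 * φ ^ 2 ≤ γ ^ 2)
    (hF : ∀ v, ‖H v - (2 * γ) • B v‖ ≤ φ * ‖v‖) :
    ∃ (S : E →ₗ[ℝ] E) (J : Finset E),
      S.IsSymmetric ∧ (∀ u, S (S u) = S u) ∧ (∀ u, S (H u) = H (S u)) ∧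
      (∀ u, ‖H (S u) - (2 * γ) • S u‖ ≤ φ * ‖S u‖) ∧
      (∀ η, 0 ≤ η → η * (2 * γ + φ) ≤ 2 → ∀ u,
        ‖(u - S u) + η • H (u - S u)‖ ≤ (1 + η * φ) * ‖u - S u‖) ∧
      (∀ u, B u = u → ‖u - S u‖ ≤ φ / γ * ‖u‖) ∧
      (∀ u, (B u = 0 ∨ B u = -u) → ‖S u‖ ≤ φ / γ * ‖u‖) ∧
      (∀ u, ‖S u‖ ^ 2 = ∑ v ∈ J, inner ℝ v u ^ 2) ∧ (∀ v ∈ J, ‖v‖ = 1) ∧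
      (J.card : ℝ) ≤ 2 * LinearMap.trace ℝ E (B ∘ₗ B) := by
  classical
  set b := hH.eigenvectorBasis rfl with hbdef
  set ev : Fin (Module.finrank ℝ E) → ℝ := hH.eigenvalues rfl with hev
  have hb : ∀ i, H (b i) = ev i • b i := fun i => by
    exact hH.apply_eigenvectorBasis rfl i
  have hφγ' : φ < γ := by nlinarith
  have hbn : ∀ i, ‖b i‖ = 1 := fun i => b.orthonormal.norm_eq_one i
  -- For a unit eigenvector of `H` the three weights sum to one, so a weighted mean of the squared
  -- distances from its eigenvalue to `2γ`, `-2γ`, `0` is at most `φ²`. Hence the eigenvalue is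
  -- within `φ` of one of the three.
  have key : ∀ i, (ev i - 2 * γ) ^ 2 * ((inner ℝ (b i) (B (B (b i))) + inner ℝ (b i) (B (b i))) / 2) +
      (ev i + 2 * γ) ^ 2 * ((inner ℝ (b i) (B (B (b i))) - inner ℝ (b i) (B (b i))) / 2) +
      ev i ^ 2 * (1 - inner ℝ (b i) (B (B (b i)))) ≤ φ ^ 2 := fun i => by
    have h := pow_le_pow_left₀ (norm_nonneg _) (hF (b i)) 2
    rw [hb, tripotent_estimate hB, hbn] at h
    linarith
  have hloc : ∀ i, (|ev i - 2 * γ| ≤ φ ∨ |ev i| ≤ φ ∨ |ev i + 2 * γ| ≤ φ) := fun i => by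
    by_contra! hcon
    obtain ⟨h1, h2, h3⟩ := hcon
    have k1 := sq_lt_sq.2 (show |φ| < |ev i - 2 * γ| by rwa [abs_of_nonneg hφ])
    have k2 := sq_lt_sq.2 (show |φ| < |ev i| by rwa [abs_of_nonneg hφ])
    have k3 := sq_lt_sq.2 (show |φ| < |ev i + 2 * γ| by rwa [abs_of_nonneg hφ])
    have hk := key i
    obtain ⟨n1, n2⟩ := tripotent_nonneg hB hB3 (b i)
    rw [hbn, one_pow] at n2
    obtain ⟨n3, n4⟩ := abs_le.1 n1
    set s := inner ℝ (b i) (B (B (b i)))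
    set r := inner ℝ (b i) (B (b i))
    rcases lt_or_ge s (1 / 2) with hs | hs
    · nlinarith [mul_nonneg (sub_nonneg.2 k1.le) (show 0 ≤ (s + r) / 2 by linarith),
        mul_nonneg (sub_nonneg.2 k3.le) (show 0 ≤ (s - r) / 2 by linarith),
        mul_pos (sub_pos.2 k2) (show 0 < 1 - s by linarith)]
    · rcases lt_or_ge r 0 with hr | hr
      · nlinarith [mul_nonneg (sub_nonneg.2 k1.le) (show 0 ≤ (s + r) / 2 by linarith),
          mul_pos (sub_pos.2 k3) (show 0 < (s - r) / 2 by linarith),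
          mul_nonneg (sub_nonneg.2 k2.le) (show 0 ≤ 1 - s by linarith)]
      · nlinarith [mul_pos (sub_pos.2 k1) (show 0 < (s + r) / 2 by linarith),
          mul_nonneg (sub_nonneg.2 k3.le) (show 0 ≤ (s - r) / 2 by linarith),
          mul_nonneg (sub_nonneg.2 k2.le) (show 0 ≤ 1 - s by linarith)]
  -- As `φ < γ`, the cut at `γ` separates the cluster around `2γ` from the other two.
  set I : Finset (Fin (Module.finrank ℝ E)) := Finset.univ.filter fun i => γ < ev i with hI
  have hmem : ∀ i, i ∈ I ↔ γ < ev i := fun i => by simp [hI]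
  have happrox : ∀ (u : E) (θ : ℝ), B u = θ • u → ‖H u - (2 * γ * θ) • u‖ ≤ φ * ‖u‖ := by
    intro u θ h
    have := hF u
    rwa [h, smul_smul] at this
  have hsmall : ∀ (u : E) (θ : ℝ), θ ≤ 0 → B u = θ • u → ‖coordProj b I u‖ ≤ φ / γ * ‖u‖ := by
    intro u θ hθ hu
    refine le_of_sq_le_sq ?_ (by positivity)
    rw [norm_sq_coordProj]
    refine sum_inner_sq_le_of_approx I hH hb hγ (happrox u θ hu) fun i hi => ?_
    have := (hmem i).1 hi
    refine le_trans ?_ (le_abs_self _)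
    nlinarith
  refine ⟨coordProj b I, I.image b, coordProj_isSymmetric b I, coordProj_idem b I,
    coordProj_comm I hH hb, ?_, ?_, ?_, ?_, ?_, ?_, ?_⟩
  · intro u
    refine le_of_sq_le_sq ?_ (by positivity)
    rw [mul_pow, norm_sq_coordProj, norm_sq_eq_sum_inner b, Finset.mul_sum,
      ← Finset.sum_subset (Finset.subset_univ I)]
    · refine Finset.sum_le_sum fun i hi => ?_
      rw [inner_sub_right, inner_eigen hH hb, real_inner_smul_right, ← sub_mul, mul_pow,
        inner_coordProj, if_pos hi]
      refine mul_le_mul_of_nonneg_right ?_ (sq_nonneg _)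
      have := (hmem i).1 hi
      refine sq_le_sq' ?_ ?_ <;> rcases hloc i with h | h | h <;> rw [abs_le] at h <;> linarith
    · intro i _ hi
      rw [inner_sub_right, inner_eigen hH hb, real_inner_smul_right, inner_coordProj, if_neg hi]
      simp
  · intro η hη hηγ u
    refine le_of_sq_le_sq ?_ (by positivity)
    rw [mul_pow, norm_sq_sub_coordProj, norm_sq_eq_sum_inner b, Finset.mul_sum,
      ← Finset.sum_subset (Finset.subset_univ Iᶜ)]
    · refine Finset.sum_le_sum fun i hi => ?_
      have hi' : i ∉ I := Finset.mem_compl.1 hi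
      rw [inner_add_right, real_inner_smul_right, inner_eigen hH hb, inner_sub_right,
        inner_coordProj, if_neg hi', sub_zero, ← mul_assoc, ← one_add_mul, mul_pow]
      refine mul_le_mul_of_nonneg_right ?_ (sq_nonneg _)
      have h' : ev i ≤ γ := not_lt.1 fun h => hi' ((hmem i).2 h)
      have h2 : ev i ≤ φ ∧ -(2 * γ + φ) ≤ ev i := by
        rcases hloc i with h | h | h <;> rw [abs_le] at h <;> constructor <;> linarith
      -- The step-size condition `η (2γ + φ) ≤ 2` is what prevents overshoot along the eigenvalues
      -- near `-2γ`.
      refine sq_le_sq' ?_ ?_ <;> nlinarith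
    · intro i _ hi
      have hi' : i ∈ I := by simpa using hi
      rw [inner_add_right, real_inner_smul_right, inner_eigen hH hb, inner_sub_right,
        inner_coordProj, if_pos hi']
      simp
  · intro u hu
    refine le_of_sq_le_sq ?_ (by positivity)
    rw [norm_sq_sub_coordProj]
    refine sum_inner_sq_le_of_approx Iᶜ hH hb hγ (happrox u 1 (by simpa using hu)) fun i hi => ?_
    have h' : ev i ≤ γ := not_lt.1 fun h => Finset.mem_compl.1 hi ((hmem i).2 h)
    refine le_trans ?_ (neg_le_abs _)
    linarith
  · rintro u (hu | hu)
    · exact hsmall u 0 le_rfl (by simpa using hu)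
    · exact hsmall u (-1) (by norm_num) (by simpa using hu)
  · intro u
    rw [norm_sq_coordProj, Finset.sum_image (b.orthonormal.linearIndependent.injective.injOn)]
  · intro v hv
    obtain ⟨i, _, rfl⟩ := Finset.mem_image.1 hv
    exact hbn i
  -- An eigenvector with eigenvalue above `γ` has weight at most `φ² / γ² ≤ 1/2` in the kernel of
  -- `B`, so it contributes at least `1/2` to the trace of `B²`.
  · rw [LinearMap.trace_eq_sum_inner _ b, Finset.mul_sum]
    refine (Nat.cast_le.2 Finset.card_image_le).trans ?_
    rw [Finset.card_eq_sum_ones, Nat.cast_sum]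
    refine (Finset.sum_le_sum fun i hi => ?_).trans
      (Finset.sum_le_sum_of_subset_of_nonneg (Finset.subset_univ I) fun i _ _ => ?_)
    · have h' := (hmem i).1 hi
      have hk := key i
      obtain ⟨n1, n2⟩ := tripotent_nonneg hB hB3 (b i)
      rw [hbn, one_pow] at n2
      obtain ⟨n3, n4⟩ := abs_le.1 n1
      rw [LinearMap.comp_apply]
      set s := inner ℝ (b i) (B (B (b i)))
      set r := inner ℝ (b i) (B (b i))
      have p1 : 0 ≤ (ev i - 2 * γ) ^ 2 * ((s + r) / 2) :=
        mul_nonneg (sq_nonneg _) (by linarith)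
      have p2 : 0 ≤ (ev i + 2 * γ) ^ 2 * ((s - r) / 2) :=
        mul_nonneg (sq_nonneg _) (by linarith)
      have p3 : γ ^ 2 * (1 - s) ≤ ev i ^ 2 * (1 - s) :=
        mul_le_mul_of_nonneg_right (pow_le_pow_left₀ hγ.le h'.le 2) (by linarith)
      have p4 : γ ^ 2 * (1 - s) ≤ γ ^ 2 * (1 / 2) := by linarith
      have p5 := le_of_mul_le_mul_left p4 (by positivity)
      push_cast
      linarith
    · have := (tripotent_nonneg hB hB3 (b i)).1
      rw [LinearMap.comp_apply]
      linarith [abs_nonneg (inner ℝ (b i) (B (b i)))]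

end Spectral

/-! ### The perturbed power iteration. -/

section Dynamics

variable {E : Type*} [NormedAddCommGroup E] [InnerProductSpace ℝ E] {H S : E →ₗ[ℝ] E}

theorem inner_proj_self (hS : S.IsSymmetric) (hSS : ∀ u, S (S u) = S u) (u : E) :
    inner ℝ (S u) u = ‖S u‖ ^ 2 := by
  rw [← real_inner_self_eq_norm_sq, hS (S u) u |>.symm, hSS]

theorem norm_sq_proj_add (hS : S.IsSymmetric) (hSS : ∀ u, S (S u) = S u) (u : E) :
    ‖u - S u‖ ^ 2 + ‖S u‖ ^ 2 = ‖u‖ ^ 2 := by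
  rw [norm_sub_sq_real, real_inner_comm, inner_proj_self hS hSS]
  ring

theorem norm_proj_le (hS : S.IsSymmetric) (hSS : ∀ u, S (S u) = S u) (u : E) :
    ‖S u‖ ≤ ‖u‖ := by
  have := norm_sq_proj_add hS hSS u
  exact le_of_sq_le_sq (by nlinarith [sq_nonneg ‖u - S u‖]) (norm_nonneg _)

theorem norm_sub_proj_le (hS : S.IsSymmetric) (hSS : ∀ u, S (S u) = S u) (u : E) :
    ‖u - S u‖ ≤ ‖u‖ := by
  have := norm_sq_proj_add hS hSS u
  exact le_of_sq_le_sq (by nlinarith [sq_nonneg ‖S u‖]) (norm_nonneg _)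

/-- Along the perturbed linear recursion the component outside the range of `S` stays bounded. -/
theorem noise_bound (hS : S.IsSymmetric) (hSS : ∀ u, S (S u) = S u)
    (hSH : ∀ u, S (H u) = H (S u)) {η φ ν A : ℝ} (hη : 0 ≤ η) (hφ : 0 ≤ φ) (hν : 0 ≤ ν)
    (hA : 0 ≤ A) (hgrow : ∀ u, ‖(u - S u) + η • H (u - S u)‖ ≤ (1 + η * φ) * ‖u - S u‖)
    {w N : ℕ → E} (hw : ∀ t, w (t + 1) = w t + η • (H (w t) + N t)) (h0 : ‖w 0‖ ≤ A) {t₁ : ℕ}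
    (hN : ∀ t < t₁, ‖N t‖ ≤ ν) (ht₁ : t₁ * (2 * η * φ * A + η * ν) ≤ A) :
    ∀ t ≤ t₁, ‖w t - S (w t)‖ ≤ A + t * (2 * η * φ * A + η * ν) := by
  intro t
  induction t with
  | zero => intro _; simpa using (norm_sub_proj_le hS hSS _).trans h0
  | succ t ih =>
    intro ht
    have ih := ih (by omega)
    have hlt : (t : ℝ) * (2 * η * φ * A + η * ν) ≤ t₁ * (2 * η * φ * A + η * ν) :=
      mul_le_mul_of_nonneg_right (by exact_mod_cast (by omega : t ≤ t₁)) (by positivity)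
    have hsplit : w (t + 1) - S (w (t + 1)) =
        ((w t - S (w t)) + η • H (w t - S (w t))) + η • (N t - S (N t)) := by
      rw [hw]
      simp only [map_add, map_smul, map_sub, hSH, smul_add, smul_sub]
      abel
    rw [hsplit]
    have h1 : ‖η • (N t - S (N t))‖ ≤ η * ν := by
      rw [norm_smul, Real.norm_of_nonneg hη]
      exact mul_le_mul_of_nonneg_left ((norm_sub_proj_le hS hSS _).trans (hN t (by omega))) hη
    refine (norm_add_le _ _).trans ((add_le_add (hgrow _) h1).trans ?_)
    -- The horizon condition keeps the component below `2A` throughout, which turns the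
    -- multiplicative growth into a constant increment.
    have h2 : η * φ * ‖w t - S (w t)‖ ≤ η * φ * (2 * A) :=
      mul_le_mul_of_nonneg_left (by linarith) (by positivity)
    push_cast
    linarith

/-- Along the perturbed linear recursion the component in the range of `S` grows like `(1 + 2ηγ)ᵗ`
and hardly changes its direction. -/
theorem signal_bound (hS : S.IsSymmetric) (hSS : ∀ u, S (S u) = S u)
    (hSH : ∀ u, S (H u) = H (S u)) {η γ φ ν : ℝ} (hη : 0 ≤ η) (hγ : 0 ≤ γ) (hφ : 0 ≤ φ)
    (hν : 0 ≤ ν) (hgrow : ∀ u, ‖H (S u) - (2 * γ) • S u‖ ≤ φ * ‖S u‖)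
    {w N : ℕ → E} (hw : ∀ t, w (t + 1) = w t + η • (H (w t) + N t)) {t₁ : ℕ}
    (hN : ∀ t < t₁, ‖N t‖ ≤ ν)
    (ht₁ : t₁ * (2 * η * φ * ‖S (w 0)‖ + η * ν) ≤ ‖S (w 0)‖) :
    ∀ t ≤ t₁, ‖S (w t) - (1 + 2 * η * γ) ^ t • S (w 0)‖ ≤
      (1 + 2 * η * γ) ^ t * (t * (2 * η * φ * ‖S (w 0)‖ + η * ν)) := by
  intro t
  set m := 1 + 2 * η * γ with hm
  have hm1 : 1 ≤ m := by rw [hm]; nlinarith [mul_nonneg hη hγ]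
  set s := ‖S (w 0)‖
  have hs : 0 ≤ s := norm_nonneg _
  induction t with
  | zero => intro _; simp
  | succ t ih =>
    intro ht
    have ih := ih (by omega)
    have hlt : (t : ℝ) * (2 * η * φ * s + η * ν) ≤ t₁ * (2 * η * φ * s + η * ν) :=
      mul_le_mul_of_nonneg_right (by exact_mod_cast (by omega : t ≤ t₁)) (by positivity)
    have hmt : 1 ≤ m ^ t := one_le_pow₀ hm1
    -- Bootstrap: by the horizon condition the error is at most the size of the main term, so the
    -- signal never exceeds twice its ideal value.
    have hst : ‖S (w t)‖ ≤ 2 * m ^ t * s := by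
      have h1 : ‖S (w t)‖ ≤ ‖S (w t) - m ^ t • S (w 0)‖ + ‖m ^ t • S (w 0)‖ := by
        simpa using norm_add_le (S (w t) - m ^ t • S (w 0)) (m ^ t • S (w 0))
      rw [norm_smul, Real.norm_of_nonneg (by positivity)] at h1
      have h2 : m ^ t * (t * (2 * η * φ * s + η * ν)) ≤ m ^ t * s :=
        mul_le_mul_of_nonneg_left (hlt.trans ht₁) (by positivity)
      linarith
    have hsplit : S (w (t + 1)) - m ^ (t + 1) • S (w 0) =
        m • (S (w t) - m ^ t • S (w 0)) + η • (H (S (w t)) - (2 * γ) • S (w t)) +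
          η • S (N t) := by
      rw [hw]
      simp only [map_add, map_smul, hSH, smul_add, smul_sub, smul_smul, hm]
      rw [pow_succ', add_smul]
      module
    rw [hsplit]
    have h1 : ‖η • S (N t)‖ ≤ η * ν := by
      rw [norm_smul, Real.norm_of_nonneg hη]
      exact mul_le_mul_of_nonneg_left ((norm_proj_le hS hSS _).trans (hN t (by omega))) hη
    have h2 : ‖η • (H (S (w t)) - (2 * γ) • S (w t))‖ ≤ η * (φ * (2 * m ^ t * s)) := by
      rw [norm_smul, Real.norm_of_nonneg hη]
      exact mul_le_mul_of_nonneg_left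
        ((hgrow _).trans (mul_le_mul_of_nonneg_left hst hφ)) hη
    have h3 : ‖m • (S (w t) - m ^ t • S (w 0))‖ ≤
        m * (m ^ t * (t * (2 * η * φ * s + η * ν))) := by
      rw [norm_smul, Real.norm_of_nonneg (by linarith)]
      exact mul_le_mul_of_nonneg_left ih (by linarith)
    refine (norm_add₃_le.trans (add_le_add (add_le_add h3 h2) h1)).trans ?_
    have hq : 0 ≤ 2 * η * φ * s + η * ν := by positivity
    have h4 : m ^ t * (2 * η * φ * s + η * ν) ≤ m ^ (t + 1) * (2 * η * φ * s + η * ν) :=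
      mul_le_mul_of_nonneg_right (pow_le_pow_right₀ hm1 (by omega)) hq
    have h5 : η * ν ≤ m ^ t * (η * ν) := le_mul_of_one_le_left (by positivity) hmt
    rw [pow_succ'] at h4 ⊢
    push_cast
    linarith

/-- The community functionals `f = (d + d') / 2`, with `d` and `d'` close to the range and to the
kernel of `S`, separate as soon as `d` does so at the start. -/
theorem separation_bound (hS : S.IsSymmetric) {z u f d d' : E} {m θ ω β ζ : ℝ} (hm : 0 ≤ m)
    (hu : ‖S u - m • z‖ ≤ m * (θ * ‖z‖)) (hθ : θ ≤ ω / 2) (hω : ω ≤ 2)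
    (hz : ω * ‖z‖ * ‖d‖ ≤ |inner ℝ z d|) (hSS : ∀ u, S (S u) = S u)
    (hd' : ‖S d'‖ ≤ β * ‖d'‖) (hdd' : ‖d'‖ = ‖d‖) (hf : (2 : ℝ) • f = d + d')
    (hr : ‖u - S u‖ ≤ ζ * ‖S u‖) (hβζ : β + 2 * ζ ≤ ω / 8) :
    ‖S u‖ * ‖d‖ * (ω / 16) ≤ |inner ℝ u f| := by
  -- The main term is `m ⟨z, d⟩`; the other three are the turning of the signal, the leakage of `S`
  -- onto `d'`, and the noise.
  have e1 : 2 * inner ℝ u f = m * inner ℝ z d + inner ℝ (S u - m • z) d + inner ℝ (S u) (S d') +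
      inner ℝ (u - S u) (d + d') := by
    have h2 : inner ℝ (S u) (S d') = inner ℝ (S u) d' := by rw [← hS, hSS]
    rw [← real_inner_smul_right, hf, h2, inner_sub_left, inner_sub_left, real_inner_smul_left,
      inner_add_right, inner_add_right]
    ring
  have b1 : |inner ℝ (S u - m • z) d| ≤ m * (θ * ‖z‖) * ‖d‖ :=
    (abs_real_inner_le_norm _ _).trans (mul_le_mul_of_nonneg_right hu (norm_nonneg _))
  have b2 : |inner ℝ (S u) (S d')| ≤ ‖S u‖ * (β * ‖d‖) := by
    refine (abs_real_inner_le_norm _ _).trans (mul_le_mul_of_nonneg_left ?_ (norm_nonneg _))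
    rwa [hdd'] at hd'
  have b3 : |inner ℝ (u - S u) (d + d')| ≤ ζ * ‖S u‖ * (2 * ‖d‖) := by
    refine (abs_real_inner_le_norm _ _).trans (mul_le_mul hr ?_ (norm_nonneg _) ?_)
    · refine (norm_add_le _ _).trans ?_
      rw [hdd']; linarith
    · exact (norm_nonneg _).trans hr
  have b4 : m * (ω * ‖z‖ * ‖d‖) ≤ |m * inner ℝ z d| := by
    rw [abs_mul, abs_of_nonneg hm]
    exact mul_le_mul_of_nonneg_left hz hm
  have b5 : ‖S u‖ ≤ 2 * (m * ‖z‖) := by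
    have h1 : ‖S u‖ ≤ ‖S u - m • z‖ + ‖m • z‖ := by
      simpa using norm_add_le (S u - m • z) (m • z)
    rw [norm_smul, Real.norm_of_nonneg hm] at h1
    have h2 : m * (θ * ‖z‖) ≤ m * (1 * ‖z‖) :=
      mul_le_mul_of_nonneg_left (mul_le_mul_of_nonneg_right (by linarith) (norm_nonneg _)) hm
    linarith
  have b6 : |m * inner ℝ z d| ≤ 2 * |inner ℝ u f| + |inner ℝ (S u - m • z) d| +
      |inner ℝ (S u) (S d')| + |inner ℝ (u - S u) (d + d')| := by
    have h : m * inner ℝ z d = 2 * inner ℝ u f - inner ℝ (S u - m • z) d - inner ℝ (S u) (S d') -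
      inner ℝ (u - S u) (d + d') := by rw [e1]; ring
    have h2 : |2 * inner ℝ u f| = 2 * |inner ℝ u f| := by
      rw [abs_mul, abs_of_pos (by norm_num : (0 : ℝ) < 2)]
    rw [h, ← h2]
    refine (abs_sub _ _).trans (add_le_add_left ((abs_sub _ _).trans (add_le_add_left (abs_sub _ _) _)) _)
  have hωn : θ ≤ ω / 2 := hθ
  have p0 : 0 ≤ m * ‖z‖ * ‖d‖ := by positivity
  have p1 : m * ‖z‖ * ‖d‖ * θ ≤ m * ‖z‖ * ‖d‖ * (ω / 2) := mul_le_mul_of_nonneg_left hωn p0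
  have p2 : ‖S u‖ * ‖d‖ * (β + 2 * ζ) ≤ ‖S u‖ * ‖d‖ * (ω / 8) :=
    mul_le_mul_of_nonneg_left hβζ (by positivity)
  rcases le_or_gt ω 0 with hω0 | hω0
  · exact (mul_nonpos_of_nonneg_of_nonpos (by positivity) (by linarith)).trans (abs_nonneg _)
  have p3 : ‖S u‖ * (‖d‖ * (ω / 4)) ≤ 2 * (m * ‖z‖) * (‖d‖ * (ω / 4)) :=
    mul_le_mul_of_nonneg_right b5 (by positivity)
  linarith

/-- A direction `ξ` along which the projection `S` is small receives little of `u`. -/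
theorem deviation_bound (hS : S.IsSymmetric) {u ξ : E} {β ζ : ℝ} (hβ : 0 ≤ β) (hζ : 0 ≤ ζ)
    (hSS : ∀ u, S (S u) = S u) (hξ : inner ℝ u ξ = ‖ξ‖ ^ 2) (hSξ : ‖S ξ‖ ≤ β * ‖ξ‖) (hr : ‖u - S u‖ ≤ ζ * ‖S u‖) :
    ‖ξ‖ ≤ (β + ζ) * ‖S u‖ := by
  rcases (norm_nonneg ξ).eq_or_lt with h | h
  · rw [← h]; positivity
  have e : inner ℝ u ξ = inner ℝ (S u) (S ξ) + inner ℝ (u - S u) ξ := by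
    have h2 : inner ℝ (S u) (S ξ) = inner ℝ (S u) ξ := by rw [← hS, hSS]
    rw [h2, inner_sub_left]; ring
  have b1 : inner ℝ (S u) (S ξ) ≤ ‖S u‖ * (β * ‖ξ‖) :=
    (real_inner_le_norm _ _).trans (mul_le_mul_of_nonneg_left hSξ (norm_nonneg _))
  have b2 : inner ℝ (u - S u) ξ ≤ ζ * ‖S u‖ * ‖ξ‖ :=
    (real_inner_le_norm _ _).trans (mul_le_mul_of_nonneg_right hr (norm_nonneg _))
  refine le_of_mul_le_mul_right ?_ h
  nlinarith

end Dynamics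

/-! ### The expected matrices as combinations of two orthogonal projections. -/

section Block

variable {n K : ℕ}

/-- The averaging matrix `J / n`. -/
def avgMat (n : ℕ) : Matrix (Fin n) (Fin n) ℝ := Matrix.of fun _ _ => (n : ℝ)⁻¹

/-- The projection onto the vectors that are constant on the communities and have mean zero. -/
def blockProj (σ : Fin n → Fin K) : Matrix (Fin n) (Fin n) ℝ :=
  Matrix.of fun i j => (if σ j = σ i then (K : ℝ) / n else 0) - (n : ℝ)⁻¹

theorem Balanced.card_eq {σ : Fin n → Fin K} (h : Balanced σ) (hK : 0 < K) (k : Fin K) :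
    ((Finset.univ.filter fun i => σ i = k).card : ℝ) = n / K := by
  have := h k
  rw [eq_div_iff (by positivity), mul_comm]
  exact_mod_cast this

theorem sum_blockProj (σ : Fin n → Fin K) (v : Fin n → ℝ) (i : Fin n) :
    ∑ j, blockProj σ i j * v j = K / n * ∑ j with σ j = σ i, v j - (n : ℝ)⁻¹ * ∑ j, v j := by
  simp only [blockProj, Matrix.of_apply, sub_mul, Finset.sum_sub_distrib, ← Finset.mul_sum, ite_mul,
    zero_mul, Finset.sum_filter]
  simp_rw [Finset.mul_sum, mul_ite, mul_zero]

theorem blockProj_transpose (σ : Fin n → Fin K) : (blockProj σ).transpose = blockProj σ := by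
  ext i j
  simp [blockProj, eq_comm]

theorem avgMat_transpose : (avgMat n).transpose = avgMat n := by
  ext i j
  simp [avgMat]

theorem avgMat_mul_self (hn : 1 ≤ n) : avgMat n * avgMat n = avgMat n := by
  have : (n : ℝ) ≠ 0 := by positivity
  ext i j
  simp [avgMat, Matrix.mul_apply]
  field_simp

theorem blockProj_mul_avgMat {σ : Fin n → Fin K} (h : Balanced σ) (hK : 0 < K) (hn : 1 ≤ n) :
    blockProj σ * avgMat n = 0 := by
  have : (n : ℝ) ≠ 0 := by positivity
  ext i j
  rw [Matrix.mul_apply, sum_blockProj]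
  simp [avgMat, h.card_eq hK]
  field_simp
  simp

theorem avgMat_mul_blockProj {σ : Fin n → Fin K} (h : Balanced σ) (hK : 0 < K) (hn : 1 ≤ n) :
    avgMat n * blockProj σ = 0 := by
  have := congrArg Matrix.transpose (blockProj_mul_avgMat h hK hn)
  rwa [Matrix.transpose_mul, blockProj_transpose, avgMat_transpose, Matrix.transpose_zero] at this

theorem blockProj_mul_self {σ : Fin n → Fin K} (h : Balanced σ) (hK : 0 < K) (hn : 1 ≤ n) :
    blockProj σ * blockProj σ = blockProj σ := by
  have hn0 : (n : ℝ) ≠ 0 := by positivity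
  have hK0 : (K : ℝ) ≠ 0 := by positivity
  have hz : ∀ j, ∑ x, blockProj σ x j = 0 := fun j => by
    have := congrFun (congrFun (avgMat_mul_blockProj h hK hn) j) j
    simp only [Matrix.mul_apply, avgMat, Matrix.of_apply, ← Finset.mul_sum, Matrix.zero_apply] at this
    simpa [hn0] using this
  ext i j
  rw [Matrix.mul_apply, sum_blockProj, hz, mul_zero, sub_zero]
  have : ∀ x ∈ Finset.univ.filter (fun x => σ x = σ i), blockProj σ x j = blockProj σ i j := by
    intro x hx
    simp only [Finset.mem_filter, Finset.mem_univ, true_and] at hx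
    simp [blockProj, hx]
  rw [Finset.sum_congr rfl this, Finset.sum_const, nsmul_eq_mul, h.card_eq hK]
  field_simp

theorem trace_blockProj (σ : Fin n → Fin K) (hn : 1 ≤ n) : (blockProj σ).trace = K - 1 := by
  have hn0 : (n : ℝ) ≠ 0 := by positivity
  simp [Matrix.trace, blockProj]
  field_simp

/-- The second eigenvalue `(p - q) / (p + (K - 1) q)` of the expected transition matrix. -/
def walkRatio (K : ℕ) (p q : ℝ) : ℝ := (p - q) / (p + ((K : ℝ) - 1) * q)

/-- The expected degree. -/
def meanDeg (n K : ℕ) (p q : ℝ) : ℝ := n / K * (p + ((K : ℝ) - 1) * q)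

theorem expAdj_eq (σ : Fin n → Fin K) {p q : unitInterval} (hK : 1 ≤ K) (hn : 1 ≤ n)
    (hden : 0 < (p : ℝ) + ((K : ℝ) - 1) * q) :
    expAdj σ p q = meanDeg n K p q • (avgMat n + walkRatio K p q • blockProj σ) := by
  have hn0 : (n : ℝ) ≠ 0 := by positivity
  have hK0 : (K : ℝ) ≠ 0 := by positivity
  ext i j
  simp only [expAdj, edgeProb, Matrix.of_apply, meanDeg, walkRatio, avgMat, blockProj,
    Matrix.smul_apply, Matrix.add_apply, smul_eq_mul]
  generalize hD : (p : ℝ) + ((K : ℝ) - 1) * q = D at hden ⊢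
  have hD0 : D ≠ 0 := hden.ne'
  by_cases h : σ i = σ j
  · rw [if_pos h, if_pos h.symm]; field_simp; rw [← hD]; ring
  · rw [if_neg h, if_neg (Ne.symm h)]; field_simp; rw [← hD]; ring

theorem deg_expAdj {σ : Fin n → Fin K} (h : Balanced σ) {p q : unitInterval} (hK : 1 ≤ K)
    (hn : 1 ≤ n) (i : Fin n) : deg (expAdj σ p q) i = meanDeg n K p q := by
  have hn0 : (n : ℝ) ≠ 0 := by positivity
  have hK0 : (K : ℝ) ≠ 0 := by positivity
  have hsum : ∀ j, expAdj σ p q i j = (if σ j = σ i then ((p : ℝ) - q) else 0) + q := fun j => by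
    simp only [expAdj, edgeProb, Matrix.of_apply, eq_comm (a := σ i)]
    split_ifs <;> simp
  simp_rw [deg, hsum, Finset.sum_add_distrib, ← Finset.sum_filter, Finset.sum_const, nsmul_eq_mul,
    h.card_eq hK, meanDeg]
  simp
  field_simp
  ring

theorem pow_avg_add_blockProj {σ : Fin n → Fin K} (h : Balanced σ) (hK : 1 ≤ K) (hn : 1 ≤ n)
    (r : ℝ) (t : ℕ) :
    (avgMat n + r • blockProj σ) ^ (t + 1) = avgMat n + r ^ (t + 1) • blockProj σ := by
  induction t with
  | zero => simp
  | succ t ih =>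
    rw [pow_succ, ih, add_mul, mul_add, mul_add, avgMat_mul_self hn, mul_smul_comm,
      avgMat_mul_blockProj h hK hn, smul_mul_assoc, blockProj_mul_avgMat h hK hn, smul_mul_smul_comm,
      blockProj_mul_self h hK hn, pow_succ r (t + 1)]
    simp

/-- The sum `2 ∑ (L - t)` of the window weights. -/
def windowMass (T L : ℕ) : ℝ := ∑ t ∈ Finset.Icc 1 T, 2 * ((L : ℝ) - t)

theorem gam_eq (T L : ℕ) (p q : ℝ) (hK : 1 ≤ K) (hn : 1 ≤ n) : gam n K T L p q =
    (∑ t ∈ Finset.Icc 1 T, ((L : ℝ) - t) * walkRatio K p q ^ t) / n := by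
  have hn0 : (n : ℝ) ≠ 0 := by positivity
  have hK0 : (K : ℝ) ≠ 0 := by positivity
  unfold gam blockGap walkRatio
  field_simp

/-- The expected graph is regular, so its transition matrix is `J/n + λ Π` with `λ` the `walkRatio`.
The two projections annihilate each other, so powers only change `λ` to `λ^t`. -/
theorem cooc_expAdj {σ : Fin n → Fin K} (h : Balanced σ) {p q : unitInterval} (T L : ℕ)
    (hK : 1 ≤ K) (hn : 1 ≤ n) (hden : 0 < (p : ℝ) + ((K : ℝ) - 1) * q) :
    cooc T L (expAdj σ p q) =
      (windowMass T L / n) • avgMat n + (2 * gam n K T L p q) • blockProj σ := by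
  have hn0 : (n : ℝ) ≠ 0 := by positivity
  set D := meanDeg n K p q with hD
  have hd : D ≠ 0 := by rw [hD, meanDeg]; positivity
  have hdeg : deg (expAdj σ p q) = fun _ => D := funext fun i => deg_expAdj h hK hn i
  have htrans : trans (expAdj σ p q) = avgMat n + walkRatio K p q • blockProj σ := by
    rw [trans, hdeg, expAdj_eq σ hK hn hden, ← hD]
    ext i j
    rw [Matrix.diagonal_mul, Matrix.smul_apply, smul_eq_mul, inv_mul_cancel_left₀ hd]
  have hsum : ∑ i, deg (expAdj σ p q) i = n * D := by simp [hdeg]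
  rw [cooc, hsum, gam_eq T L p q hK hn, windowMass, Finset.sum_div, Finset.sum_div, Finset.mul_sum,
    Finset.sum_smul, Finset.sum_smul, ← Finset.sum_add_distrib]
  refine Finset.sum_congr rfl fun t ht => ?_
  obtain ⟨s, rfl⟩ : ∃ s, t = s + 1 := ⟨t - 1, by have := (Finset.mem_Icc.1 ht).1; omega⟩
  rw [htrans, pow_avg_add_blockProj h hK hn, degMat, hdeg]
  ext i j
  simp only [Matrix.smul_apply, Matrix.diagonal_mul, Matrix.add_apply, smul_eq_mul]
  field_simp

end Block

/-! ### Symmetric operators on stacked vectors, and spectral norm bounds. -/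

section OffDiag

variable {n : ℕ}

/-- The symmetric operator `(x, y) ↦ (X y, Xᵀ x)`. -/
def offDiag (X : Matrix (Fin n) (Fin n) ℝ) :
    EuclideanSpace ℝ (Fin n ⊕ Fin n) →ₗ[ℝ] EuclideanSpace ℝ (Fin n ⊕ Fin n) :=
  Matrix.toEuclideanLin (Matrix.fromBlocks 0 X X.transpose 0)

theorem offDiag_isSymmetric (X : Matrix (Fin n) (Fin n) ℝ) : (offDiag X).IsSymmetric := by
  rw [offDiag, Matrix.isSymmetric_toEuclideanLin_iff, Matrix.IsHermitian,
    Matrix.conjTranspose_eq_transpose_of_trivial, Matrix.fromBlocks_transpose]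
  simp

theorem offDiag_inl (X : Matrix (Fin n) (Fin n) ℝ) (w : EuclideanSpace ℝ (Fin n ⊕ Fin n))
    (i : Fin n) : offDiag X w (.inl i) = ∑ j, X i j * w (.inr j) := by
  simp [offDiag, Matrix.toLpLin_apply, Matrix.mulVec, dotProduct]

theorem offDiag_inr (X : Matrix (Fin n) (Fin n) ℝ) (w : EuclideanSpace ℝ (Fin n ⊕ Fin n))
    (i : Fin n) : offDiag X w (.inr i) = ∑ j, X j i * w (.inl j) := by
  simp [offDiag, Matrix.toLpLin_apply, Matrix.mulVec, dotProduct]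

theorem ext_halves {u v : EuclideanSpace ℝ (Fin n ⊕ Fin n)}
    (hl : ∀ i, u (.inl i) = v (.inl i)) (hr : ∀ i, u (.inr i) = v (.inr i)) : u = v := by
  ext (i | i)
  · exact hl i
  · exact hr i

theorem offDiag_add (X Y : Matrix (Fin n) (Fin n) ℝ) : offDiag (X + Y) = offDiag X + offDiag Y := by
  refine LinearMap.ext fun w => ext_halves (fun i => ?_) fun i => ?_
  · simp [offDiag_inl, add_mul, Finset.sum_add_distrib]
  · simp [offDiag_inr, add_mul, Finset.sum_add_distrib]

theorem offDiag_smul (c : ℝ) (X : Matrix (Fin n) (Fin n) ℝ) : offDiag (c • X) = c • offDiag X := by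
  refine LinearMap.ext fun w => ext_halves (fun i => ?_) fun i => ?_
  · simp [offDiag_inl, mul_assoc, Finset.mul_sum]
  · simp [offDiag_inr, mul_assoc, Finset.mul_sum]

theorem norm_sq_halves (w : EuclideanSpace ℝ (Fin n ⊕ Fin n)) :
    ‖w‖ ^ 2 = ∑ i, w (.inl i) ^ 2 + ∑ i, w (.inr i) ^ 2 := by
  rw [EuclideanSpace.real_norm_sq_eq, Fintype.sum_sum_type]

theorem inner_halves (u v : EuclideanSpace ℝ (Fin n ⊕ Fin n)) :
    inner ℝ u v = ∑ i, u (.inl i) * v (.inl i) + ∑ i, u (.inr i) * v (.inr i) := by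
  rw [PiLp.inner_apply, Fintype.sum_sum_type]
  simp [mul_comm]

theorem specNorm_nonneg (X : Matrix (Fin n) (Fin n) ℝ) : 0 ≤ specNorm X := norm_nonneg _

theorem sum_sq_mulVec_le (X : Matrix (Fin n) (Fin n) ℝ) (v : Fin n → ℝ) :
    ∑ i, (∑ j, X i j * v j) ^ 2 ≤ specNorm X ^ 2 * ∑ i, v i ^ 2 := by
  have h := (Matrix.toEuclideanCLM (𝕜 := ℝ) (n := Fin n) X).le_opNorm (WithLp.toLp 2 v)
  have h2 := pow_le_pow_left₀ (norm_nonneg _) h 2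
  rw [mul_pow, EuclideanSpace.real_norm_sq_eq, EuclideanSpace.real_norm_sq_eq] at h2
  simpa [Matrix.mulVec, dotProduct, specNorm] using h2

theorem specNorm_le_of_forall {X : Matrix (Fin n) (Fin n) ℝ} {a : ℝ} (ha : 0 ≤ a)
    (h : ∀ v : Fin n → ℝ, ∑ i, (∑ j, X i j * v j) ^ 2 ≤ a ^ 2 * ∑ i, v i ^ 2) :
    specNorm X ≤ a := by
  refine ContinuousLinearMap.opNorm_le_bound _ ha fun v => ?_
  refine le_of_sq_le_sq ?_ (by positivity)
  rw [mul_pow, EuclideanSpace.real_norm_sq_eq, EuclideanSpace.real_norm_sq_eq]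
  simpa [Matrix.mulVec, dotProduct] using h v.ofLp

theorem specNorm_transpose (X : Matrix (Fin n) (Fin n) ℝ) : specNorm X.transpose = specNorm X := by
  rw [specNorm, ← Matrix.conjTranspose_eq_transpose_of_trivial, ← Matrix.star_eq_conjTranspose,
    map_star, ContinuousLinearMap.star_eq_adjoint, LinearIsometryEquiv.norm_map, specNorm]

theorem specNorm_mul_le (X Y : Matrix (Fin n) (Fin n) ℝ) :
    specNorm (X * Y) ≤ specNorm X * specNorm Y := by
  rw [specNorm, map_mul]
  exact norm_mul_le _ _

theorem specNorm_sq_le_sum_sq (X : Matrix (Fin n) (Fin n) ℝ) {a : ℝ} (ha : 0 ≤ a)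
    (h : ∑ i, ∑ j, X i j ^ 2 ≤ a ^ 2) : specNorm X ≤ a := by
  refine specNorm_le_of_forall ha fun v => ?_
  refine le_trans ?_ (mul_le_mul_of_nonneg_right h (Finset.sum_nonneg fun i _ => sq_nonneg (v i)))
  rw [Finset.sum_mul]
  exact Finset.sum_le_sum fun i _ => Finset.sum_mul_sq_le_sq_mul_sq _ _ _

theorem norm_offDiag_le (X : Matrix (Fin n) (Fin n) ℝ) (w : EuclideanSpace ℝ (Fin n ⊕ Fin n)) :
    ‖offDiag X w‖ ≤ specNorm X * ‖w‖ := by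
  refine le_of_sq_le_sq ?_ (mul_nonneg (specNorm_nonneg _) (norm_nonneg _))
  rw [mul_pow, norm_sq_halves, norm_sq_halves]
  simp_rw [offDiag_inl, offDiag_inr]
  have h1 := sum_sq_mulVec_le X fun j => w (.inr j)
  have h2 := sum_sq_mulVec_le X.transpose fun j => w (.inl j)
  rw [specNorm_transpose] at h2
  simp only [Matrix.transpose_apply] at h2
  linarith

theorem offDiag_offDiag (X : Matrix (Fin n) (Fin n) ℝ) (w : EuclideanSpace ℝ (Fin n ⊕ Fin n)) :
    offDiag X (offDiag X w) = Matrix.toEuclideanLin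
      (Matrix.fromBlocks (X * X.transpose) 0 0 (X.transpose * X)) w := by
  rw [offDiag, Matrix.toLpLin_apply, Matrix.toLpLin_apply,
    Matrix.toLpLin_apply, Matrix.mulVec_mulVec, Matrix.fromBlocks_multiply]
  simp

/-- Applying the operator twice gives the block diagonal matrix with two copies of the projection
`X`; this supplies the relation `B³ = B`. -/
theorem offDiag_tripotent {X : Matrix (Fin n) (Fin n) ℝ} (hX : X.transpose = X) (hXX : X * X = X)
    (w : EuclideanSpace ℝ (Fin n ⊕ Fin n)) :
    offDiag X (offDiag X (offDiag X w)) = offDiag X w := by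
  rw [offDiag_offDiag, hX, hXX, offDiag, Matrix.toLpLin_apply,
    Matrix.toLpLin_apply, Matrix.mulVec_mulVec, Matrix.fromBlocks_multiply]
  simp [hX, hXX]

theorem trace_offDiag_sq {X : Matrix (Fin n) (Fin n) ℝ} (hX : X.transpose = X) (hXX : X * X = X) :
    LinearMap.trace ℝ _ (offDiag X ∘ₗ offDiag X) = 2 * X.trace := by
  have : offDiag X ∘ₗ offDiag X = Matrix.toEuclideanLin (Matrix.fromBlocks X 0 0 X) := by
    ext1 w
    rw [LinearMap.comp_apply, offDiag_offDiag, hX, hXX]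
  rw [this, Matrix.toEuclideanLin, Matrix.toLpLin_eq_toLin, Matrix.trace_toLin_eq]
  simp [Matrix.trace, two_mul]

theorem specNorm_one_sub_avgMat_le (hn : 1 ≤ n) : specNorm (1 - avgMat n) ≤ 1 := by
  have hn0 : (n : ℝ) ≠ 0 := by positivity
  refine specNorm_le_of_forall zero_le_one fun v => ?_
  set s := (n : ℝ)⁻¹ * ∑ j, v j with hs
  have h : ∀ i, ∑ j, (1 - avgMat n) i j * v j = v i - s := fun i => by
    simp [avgMat, Matrix.sub_apply, sub_mul, Finset.sum_sub_distrib, Matrix.one_apply, hs,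
      Finset.mul_sum]
  simp_rw [h, sub_sq, Finset.sum_add_distrib, Finset.sum_sub_distrib, ← Finset.sum_mul,
    ← Finset.mul_sum]
  have hv : ∑ j, v j = n * s := by rw [hs]; field_simp
  rw [hv]
  simp
  have : 0 ≤ (n : ℝ) * s ^ 2 := by positivity
  nlinarith

end OffDiag

/-! ### Linearization of the gradient at the origin, and its error. -/

section Gradient

variable {n : ℕ}

theorem l2_eq_norm (w : Emb n) : l2 w = ‖WithLp.toLp 2 w‖ := by
  rw [l2, EuclideanSpace.norm_eq]
  simp

/-- The deviation of the gradient from its linearization at the origin. -/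
def gradErr (C : Matrix (Fin n) (Fin n) ℝ) (w : Emb n) : Matrix (Fin n) (Fin n) ℝ :=
  Matrix.of fun i j => deg C i * ((n : ℝ)⁻¹ - softmax w i j)

/-- With uniform softmax weights, `D_C (J/n)` and `C (J/n)` both have every entry of row `i` equal
to `d_i / n`. -/
theorem neg_gradMat_eq (C : Matrix (Fin n) (Fin n) ℝ) (w : Emb n) :
    -gradMat C w = C * (1 - avgMat n) + gradErr C w := by
  ext i j
  rw [gradMat, degMat, Matrix.neg_apply, Matrix.sub_apply, Matrix.diagonal_mul, mul_sub, mul_one]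
  simp [gradErr, mul_sub, Matrix.mul_apply, avgMat, deg, Finset.sum_mul]

theorem toLp_step (C : Matrix (Fin n) (Fin n) ℝ) (η : ℝ) (w : Emb n) :
    WithLp.toLp 2 (step C η w) = WithLp.toLp 2 w + η • (offDiag (C * (1 - avgMat n))
      (WithLp.toLp 2 w) + offDiag (gradErr C w) (WithLp.toLp 2 w)) := by
  rw [← LinearMap.add_apply, ← offDiag_add, ← neg_gradMat_eq]
  refine ext_halves (fun i => ?_) fun i => ?_
  · rw [PiLp.add_apply, PiLp.smul_apply, offDiag_inl]
    simp [step, Matrix.mulVec, dotProduct, Finset.mul_sum, mul_assoc]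
    simp [Matrix.one_apply]
  · rw [PiLp.add_apply, PiLp.smul_apply, offDiag_inr]
    simp [step, Matrix.mulVec, dotProduct, Finset.mul_sum, mul_assoc]
    simp [Matrix.one_apply, add_comm]

/-- Numerator and average denominator both lie in `[e^(-s), e^s]`, so each weight is `1/n` up to a
factor between `e^(-2s)` and `e^(2s)`. -/
theorem abs_softmax_weight_sub_le {a : Fin n → ℝ} {s : ℝ} (hs : s ≤ 1 / 2) (ha : ∀ j, |a j| ≤ s)
    (j : Fin n) : |(n : ℝ)⁻¹ - Real.exp (a j) / ∑ k, Real.exp (a k)| ≤ 4 * s / n := by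
  have hn : 0 < (n : ℝ) := by exact_mod_cast j.pos
  have hs0 : 0 ≤ s := (abs_nonneg _).trans (ha j)
  set Z := ∑ k, Real.exp (a k) with hZ
  have hZu : Z ≤ n * Real.exp s := by
    have := Finset.sum_le_sum fun k (_ : k ∈ Finset.univ) => Real.exp_le_exp.2 (abs_le.1 (ha k)).2
    simpa using this
  have hZl : n * Real.exp (-s) ≤ Z := by
    have := Finset.sum_le_sum fun k (_ : k ∈ Finset.univ) => Real.exp_le_exp.2 (abs_le.1 (ha k)).1
    simpa using this
  have hZ0 : 0 < Z := lt_of_lt_of_le (by positivity) hZl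
  have hju := Real.exp_le_exp.2 (abs_le.1 (ha j)).2
  have hjl := Real.exp_le_exp.2 (abs_le.1 (ha j)).1
  have e1 : Real.exp (2 * s) ≤ 1 + 4 * s := by
    have := Real.abs_exp_sub_one_le (x := 2 * s) (by rw [abs_le]; constructor <;> linarith)
    rw [abs_of_nonneg (by linarith : 0 ≤ 2 * s)] at this
    linarith [(abs_le.1 this).2]
  have e2 : 1 - 4 * s ≤ Real.exp (-(2 * s)) := by
    linarith [Real.add_one_le_exp (-(2 * s))]
  have u1 : Real.exp (a j) / Z ≤ (1 + 4 * s) / n := by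
    rw [div_le_div_iff₀ hZ0 hn]
    calc Real.exp (a j) * n ≤ Real.exp s * n := by gcongr
      _ = Real.exp (2 * s) * (n * Real.exp (-s)) := by
        rw [mul_left_comm, ← Real.exp_add]; ring_nf
      _ ≤ (1 + 4 * s) * Z := by gcongr
  have u2 : (1 - 4 * s) / n ≤ Real.exp (a j) / Z := by
    rw [div_le_div_iff₀ hn hZ0]
    calc (1 - 4 * s) * Z ≤ Real.exp (-(2 * s)) * Z := by gcongr
      _ ≤ Real.exp (-(2 * s)) * (n * Real.exp s) := by gcongr
      _ = Real.exp (-s) * n := by rw [mul_left_comm, ← Real.exp_add]; ring_nf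
      _ ≤ Real.exp (a j) * n := by gcongr
  rw [add_div] at u1
  rw [sub_div] at u2
  rw [← one_div, abs_le]
  constructor <;> linarith

/-- The bound is on the Frobenius norm. Estimating `|x_i y_j|` by `|x_i| ‖w‖` keeps the dependence
on `i`, and summing `x_i²` rather than a uniform bound produces the factor `1/√n`. -/
theorem specNorm_gradErr_le (hn : 1 ≤ n) {C : Matrix (Fin n) (Fin n) ℝ} {D : ℝ} (hD : 0 ≤ D)
    (hdeg : ∀ i, |deg C i| ≤ D) (w : Emb n) (hw : l2 w ^ 2 ≤ 1 / 2) :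
    specNorm (gradErr C w) ≤ 4 * D * l2 w ^ 2 / √n := by
  have hn0 : 0 < (n : ℝ) := by exact_mod_cast hn
  have hsq : l2 w ^ 2 = ∑ i, w (.inl i) ^ 2 + ∑ i, w (.inr i) ^ 2 := by
    rw [l2_eq_norm, norm_sq_halves]
  have hl0 : 0 ≤ l2 w := Real.sqrt_nonneg _
  set X := ∑ i, w (.inl i) ^ 2 with hX
  set Y := ∑ i, w (.inr i) ^ 2 with hY
  have hX0 : 0 ≤ X := Finset.sum_nonneg fun i _ => sq_nonneg _
  have hY0 : 0 ≤ Y := Finset.sum_nonneg fun i _ => sq_nonneg _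
  have hx : ∀ i, |w (.inl i)| ≤ l2 w := fun i => by
    refine abs_le_of_sq_le_sq ?_ hl0
    have := Finset.single_le_sum (f := fun i => w (.inl i) ^ 2) (fun i _ => sq_nonneg _)
      (Finset.mem_univ i)
    linarith
  have hy : ∀ i, |w (.inr i)| ≤ l2 w := fun i => by
    refine abs_le_of_sq_le_sq ?_ hl0
    have := Finset.single_le_sum (f := fun i => w (.inr i) ^ 2) (fun i _ => sq_nonneg _)
      (Finset.mem_univ i)
    linarith
  have hent : ∀ i j, |gradErr C w i j| ≤ D * (4 * (|w (.inl i)| * l2 w) / n) := fun i j => by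
    rw [gradErr, Matrix.of_apply, abs_mul]
    refine mul_le_mul (hdeg i) ?_ (abs_nonneg _) hD
    refine abs_softmax_weight_sub_le (a := fun k => w (.inl i) * w (.inr k)) ?_ (fun k => ?_) j
    · nlinarith [hx i]
    · rw [abs_mul]
      exact mul_le_mul_of_nonneg_left (hy k) (abs_nonneg _)
  refine specNorm_sq_le_sum_sq _ (by positivity) ?_
  have h1 : ∀ i j, gradErr C w i j ^ 2 ≤ (4 * D * l2 w / n) ^ 2 * w (.inl i) ^ 2 := fun i j => by
    rw [← sq_abs, ← sq_abs (w (.inl i)), ← mul_pow]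
    refine pow_le_pow_left₀ (abs_nonneg _) ((hent i j).trans_eq ?_) 2
    ring
  refine (Finset.sum_le_sum fun i _ => Finset.sum_le_sum fun j _ => h1 i j).trans ?_
  simp only [Finset.sum_const, Finset.card_univ, Fintype.card_fin, nsmul_eq_mul]
  rw [← Finset.mul_sum, ← Finset.mul_sum, ← hX, div_pow, div_pow, Real.sq_sqrt hn0.le]
  have h2 : X ≤ l2 w ^ 2 := by linarith
  calc (n : ℝ) * ((4 * D * l2 w) ^ 2 / n ^ 2 * X) = (4 * D * l2 w) ^ 2 / n * X := by field_simp
    _ ≤ (4 * D * l2 w) ^ 2 / n * l2 w ^ 2 := by gcongr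
    _ = (4 * D * l2 w ^ 2) ^ 2 / n := by ring

/-- The row sums are the coordinates of `X 𝟏`, and `‖𝟏‖ = √n`. -/
theorem abs_deg_le (X : Matrix (Fin n) (Fin n) ℝ) (i : Fin n) :
    |deg X i| ≤ specNorm X * √n := by
  refine abs_le_of_sq_le_sq ?_ (mul_nonneg (specNorm_nonneg _) (Real.sqrt_nonneg _))
  have h := sum_sq_mulVec_le X fun _ => 1
  simp only [mul_one, one_pow, Finset.sum_const, Finset.card_univ, Fintype.card_fin,
    nsmul_eq_mul] at h
  rw [mul_pow, Real.sq_sqrt (Nat.cast_nonneg n)]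
  exact (Finset.single_le_sum (f := fun i => (∑ j, X i j) ^ 2) (fun i _ => sq_nonneg _)
    (Finset.mem_univ i)).trans h

theorem deg_add (X Y : Matrix (Fin n) (Fin n) ℝ) (i : Fin n) :
    deg (X + Y) i = deg X i + deg Y i := by
  simp [deg, Finset.sum_add_distrib]

end Gradient

/-! ### Community means and deviations as inner products with eigenvectors of `B`. -/

section Community

variable {n K : ℕ} {σ : Fin n → Fin K}

/-- The functional `x ↦ μ_k - μ_l` as a vector. -/
def meanDiff (σ : Fin n → Fin K) (k l : Fin K) (i : Fin n) : ℝ :=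
  (if σ i = k then (K : ℝ) / n else 0) - if σ i = l then (K : ℝ) / n else 0

/-- The deviation of the `x`-embedding from the community means. -/
def meanDev (σ : Fin n → Fin K) (w : Emb n) (i : Fin n) : ℝ :=
  w (.inl i) - clusterMean σ w (σ i)

/-- The stacked vector `(x, y)`. -/
def pairVec (x y : Fin n → ℝ) : EuclideanSpace ℝ (Fin n ⊕ Fin n) := WithLp.toLp 2 (Sum.elim x y)

@[simp] theorem pairVec_inl (x y : Fin n → ℝ) (i : Fin n) : pairVec x y (.inl i) = x i := rfl

@[simp] theorem pairVec_inr (x y : Fin n → ℝ) (i : Fin n) : pairVec x y (.inr i) = y i := rfl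

theorem clusterMean_eq (h : Balanced σ) (hK : 1 ≤ K) (w : Emb n) (k : Fin K) :
    clusterMean σ w k = K / n * ∑ i with σ i = k, w (.inl i) := by
  rw [clusterMean, h.card_eq hK, div_div_eq_mul_div, mul_div_assoc, mul_comm]

theorem inner_meanDiff (h : Balanced σ) (hK : 1 ≤ K) (w : Emb n) (k l : Fin K) :
    inner ℝ (WithLp.toLp 2 w) (pairVec (meanDiff σ k l) 0) =
      clusterMean σ w k - clusterMean σ w l := by
  rw [inner_halves, clusterMean_eq h hK, clusterMean_eq h hK]
  simp [meanDiff, sub_mul, Finset.sum_sub_distrib, Finset.sum_filter, Finset.mul_sum,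
    mul_comm (w _)]

theorem sum_meanDiff_eq_zero (h : Balanced σ) (hK : 1 ≤ K) (k l : Fin K) :
    ∑ i, meanDiff σ k l i = 0 := by
  simp [meanDiff, Finset.sum_sub_distrib, ← Finset.sum_filter, h.card_eq hK]

theorem blockProj_meanDiff (h : Balanced σ) (hK : 1 ≤ K) (hn : 1 ≤ n) (k l : Fin K) (i : Fin n) :
    ∑ j, blockProj σ i j * meanDiff σ k l j = meanDiff σ k l i := by
  have hn0 : (n : ℝ) ≠ 0 := by positivity
  have hK0 : (K : ℝ) ≠ 0 := by positivity
  rw [sum_blockProj, sum_meanDiff_eq_zero h hK, mul_zero, sub_zero]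
  have : ∀ j ∈ Finset.univ.filter (fun j => σ j = σ i), meanDiff σ k l j = meanDiff σ k l i := by
    intro j hj
    simp only [Finset.mem_filter, Finset.mem_univ, true_and] at hj
    simp [meanDiff, hj]
  rw [Finset.sum_congr rfl this, Finset.sum_const, nsmul_eq_mul, h.card_eq hK]
  field_simp

theorem sum_meanDiff_sq (h : Balanced σ) (hK : 1 ≤ K) (hn : 1 ≤ n) {k l : Fin K} (hkl : k ≠ l) :
    ∑ i, meanDiff σ k l i ^ 2 = 2 * K / n := by
  have hn0 : (n : ℝ) ≠ 0 := by positivity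
  have hK0 : (K : ℝ) ≠ 0 := by positivity
  have : ∀ i, meanDiff σ k l i ^ 2 =
      (if σ i = k then ((K : ℝ) / n) ^ 2 else 0) + if σ i = l then ((K : ℝ) / n) ^ 2 else 0 := by
    intro i
    unfold meanDiff
    by_cases h1 : σ i = k
    · have h2 : σ i ≠ l := fun h2 => hkl (h1 ▸ h2)
      simp [h1, hkl]
    · simp [h1]
  simp_rw [this, Finset.sum_add_distrib, ← Finset.sum_filter, Finset.sum_const, nsmul_eq_mul,
    h.card_eq hK]
  field_simp
  ring

theorem offDiag_blockProj_meanDiff (h : Balanced σ) (hK : 1 ≤ K) (hn : 1 ≤ n) (k l : Fin K) :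
    offDiag (blockProj σ) (pairVec (meanDiff σ k l) (meanDiff σ k l)) =
      pairVec (meanDiff σ k l) (meanDiff σ k l) := by
  refine ext_halves (fun i => ?_) fun i => ?_
  · simpa [offDiag_inl] using blockProj_meanDiff h hK hn k l i
  · simp only [offDiag_inr, pairVec_inl, pairVec_inr]
    rw [← blockProj_meanDiff h hK hn k l i]
    simp_rw [← Matrix.transpose_apply (blockProj σ) i, blockProj_transpose]

theorem offDiag_blockProj_meanDiff_neg (h : Balanced σ) (hK : 1 ≤ K) (hn : 1 ≤ n) (k l : Fin K) :
    offDiag (blockProj σ) (pairVec (meanDiff σ k l) (-meanDiff σ k l)) =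
      -pairVec (meanDiff σ k l) (-meanDiff σ k l) := by
  refine ext_halves (fun i => ?_) fun i => ?_
  · simpa [offDiag_inl] using blockProj_meanDiff h hK hn k l i
  · simp only [offDiag_inr, pairVec_inl, PiLp.neg_apply, pairVec_inr, Pi.neg_apply, neg_neg]
    rw [← blockProj_meanDiff h hK hn k l i]
    simp_rw [← Matrix.transpose_apply (blockProj σ) i, blockProj_transpose]

theorem sum_meanDev (h : Balanced σ) (hK : 1 ≤ K) (hn : 1 ≤ n) (w : Emb n) (k : Fin K) :
    ∑ i with σ i = k, meanDev σ w i = 0 := by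
  have hn0 : (n : ℝ) ≠ 0 := by positivity
  have hK0 : (K : ℝ) ≠ 0 := by positivity
  have : ∀ i ∈ Finset.univ.filter (fun i => σ i = k),
      meanDev σ w i = w (.inl i) - clusterMean σ w k := by
    intro i hi
    simp only [Finset.mem_filter, Finset.mem_univ, true_and] at hi
    rw [meanDev, hi]
  rw [Finset.sum_congr rfl this, Finset.sum_sub_distrib, Finset.sum_const, nsmul_eq_mul,
    h.card_eq hK, clusterMean_eq h hK]
  field_simp
  simp

theorem sum_mul_meanDev (h : Balanced σ) (hK : 1 ≤ K) (hn : 1 ≤ n) (w : Emb n) (c : Fin K → ℝ) :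
    ∑ i, c (σ i) * meanDev σ w i = 0 := by
  rw [← Finset.sum_fiberwise_of_maps_to (fun i _ => Finset.mem_univ (σ i))]
  refine Finset.sum_eq_zero fun k _ => ?_
  have : ∀ i ∈ Finset.univ.filter (fun i => σ i = k),
      c (σ i) * meanDev σ w i = c k * meanDev σ w i := by
    intro i hi
    rw [(Finset.mem_filter.1 hi).2]
  rw [Finset.sum_congr rfl this, ← Finset.mul_sum, sum_meanDev h hK hn, mul_zero]

theorem offDiag_blockProj_meanDev (h : Balanced σ) (hK : 1 ≤ K) (hn : 1 ≤ n) (w : Emb n) :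
    offDiag (blockProj σ) (pairVec (meanDev σ w) 0) = 0 := by
  refine ext_halves (fun i => ?_) fun i => ?_
  · simp [offDiag_inl]
  · simp only [offDiag_inr, pairVec_inl, PiLp.zero_apply]
    simp_rw [← Matrix.transpose_apply (blockProj σ) i, blockProj_transpose]
    rw [sum_blockProj, sum_meanDev h hK hn]
    have := sum_mul_meanDev h hK hn w fun _ => 1
    simp only [one_mul] at this
    rw [this]; simp

/-- The deviation is orthogonal to everything constant on communities, in particular to the vector
of means. -/
theorem inner_meanDev (h : Balanced σ) (hK : 1 ≤ K) (hn : 1 ≤ n) (w : Emb n) :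
    inner ℝ (WithLp.toLp 2 w) (pairVec (meanDev σ w) 0) = ‖pairVec (meanDev σ w) 0‖ ^ 2 := by
  rw [inner_halves, norm_sq_halves]
  have := sum_mul_meanDev h hK hn w (clusterMean σ w)
  simp only [pairVec_inl, pairVec_inr, Pi.zero_apply, mul_zero, Finset.sum_const_zero, add_zero, ne_eq,
    OfNat.ofNat_ne_zero, not_false_eq_true, zero_pow]
  rw [← sub_eq_zero, ← Finset.sum_sub_distrib, ← this]
  refine Finset.sum_congr rfl fun i _ => ?_
  rw [meanDev]; ring

open Classical in
/-- If the community means are `s`-separated, then few vertices with large deviation exist. -/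
theorem recoversFraction_of_bounds (h : Balanced σ) (hK : 1 ≤ K) {w : Emb n} {s err : ℝ}
    (hs : 0 < s) (hsep : ∀ k l, k ≠ l → s ≤ |clusterMean σ w k - clusterMean σ w l|)
    (hdev : ∑ i, meanDev σ w i ^ 2 ≤ err * (n / K) * (s / 2) ^ 2) : RecoversFraction σ w err := by
  intro k
  set V := Finset.univ.filter fun j => σ j = k with hV
  set U := V.filter fun j => ¬ Recovered σ w j with hU
  have hbad : ∀ j ∈ U, (s / 2) ^ 2 ≤ meanDev σ w j ^ 2 := by
    intro j hj
    have hj2 := (Finset.mem_filter.1 hj).2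
    simp only [Recovered, not_forall, not_lt] at hj2
    obtain ⟨k', l', hkl, hle⟩ := hj2
    rw [← sq_abs (meanDev σ w j)]
    refine pow_le_pow_left₀ (by positivity) ?_ 2
    have := hsep k' l' hkl
    unfold meanDev
    linarith
  have hcard : (U.card : ℝ) * (s / 2) ^ 2 ≤ err * (n / K) * (s / 2) ^ 2 := by
    have h1 := Finset.sum_le_sum hbad
    rw [Finset.sum_const, nsmul_eq_mul] at h1
    exact h1.trans ((Finset.sum_le_sum_of_subset_of_nonneg (Finset.subset_univ U)
      fun i _ _ => sq_nonneg _).trans hdev)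
  have hcard' := le_of_mul_le_mul_right hcard (by positivity)
  have hsplit : (V.filter fun j => Recovered σ w j).card + U.card = V.card :=
    Finset.card_filter_add_card_filter_not _
  have hVc : (V.card : ℝ) = n / K := h.card_eq hK k
  have hfil : (Finset.univ.filter fun j => σ j = k ∧ Recovered σ w j) =
      V.filter fun j => Recovered σ w j := by
    rw [hV, Finset.filter_filter]
  have hsplit' : ((V.filter fun j => Recovered σ w j).card : ℝ) + U.card = V.card := by
    exact_mod_cast hsplit
  rw [hfil, hVc]
  rw [hVc] at hsplit'
  linarith

end Community

/-! ### Anticoncentration and second moments of the Gaussian start. -/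

section Gaussian

/-- The density is at most `1/√(2π) ≤ 1/2` and the interval has length `2τ`. -/
theorem gaussianReal_abs_lt_le (τ : ℝ) :
    gaussianReal 0 1 {x | |x| < τ} ≤ ENNReal.ofReal τ := by
  rcases le_or_gt τ 0 with hτ | hτ
  · have : {x : ℝ | |x| < τ} = ∅ := by
      ext x
      simpa using hτ.trans (abs_nonneg x)
    simp [this]
  rw [gaussianReal_apply _ one_ne_zero]
  have hset : {x : ℝ | |x| < τ} = Set.Ioo (-τ) τ := by
    ext x
    simp [abs_lt]
  have hpdf : ∀ x, gaussianPDF 0 1 x ≤ ENNReal.ofReal (1 / 2) := fun x => by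
    rw [gaussianPDF]
    refine ENNReal.ofReal_le_ofReal ?_
    rw [gaussianPDFReal]
    have h1 : (√(2 * Real.pi * (1 : NNReal)))⁻¹ ≤ 1 / 2 := by
      rw [one_div]
      refine inv_anti₀ (by norm_num) (Real.le_sqrt_of_sq_le ?_)
      have := Real.pi_gt_three
      push_cast
      linarith
    have h2 : Real.exp (-(x - 0) ^ 2 / (2 * (1 : NNReal))) ≤ 1 := by
      refine Real.exp_le_one_iff.2 ?_
      have := sq_nonneg (x - 0)
      push_cast
      linarith
    calc _ ≤ 1 / 2 * 1 := mul_le_mul h1 h2 (Real.exp_nonneg _) (by norm_num)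
      _ = 1 / 2 := by norm_num
  rw [hset]
  refine (setLIntegral_mono measurable_const fun x _ => hpdf x).trans ?_
  rw [setLIntegral_const, Real.volume_Ioo, ← ENNReal.ofReal_mul (by norm_num)]
  refine ENNReal.ofReal_le_ofReal ?_
  linarith

theorem lintegral_sq_gaussianReal : ∫⁻ x, ENNReal.ofReal (x ^ 2) ∂(gaussianReal 0 1) = 1 := by
  have hint : Integrable (fun x : ℝ => x ^ 2) (gaussianReal 0 1) :=
    (IsGaussian.memLp_two_id (μ := gaussianReal 0 1)).integrable_sq
  rw [← ofReal_integral_eq_lintegral_ofReal hint (ae_of_all _ fun x => sq_nonneg x)]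
  have h := variance_eq_integral (μ := gaussianReal 0 1) (X := id) measurable_id.aemeasurable
  rw [variance_id_gaussianReal] at h
  simp at h
  simp [← h]

variable {n : ℕ}

instance : IsProbabilityMeasure (gaussInit n) := by
  unfold gaussInit; infer_instance

theorem map_inner_gaussInit {v : EuclideanSpace ℝ (Fin n ⊕ Fin n)} (hv : ‖v‖ = 1) :
    (gaussInit n).map (fun g => inner ℝ v (WithLp.toLp 2 g)) = gaussianReal 0 1 := by
  have h1 : (fun g : Emb n => inner ℝ v (WithLp.toLp 2 g)) =
      ⇑(innerSL ℝ v) ∘ (WithLp.toLp 2 : Emb n → EuclideanSpace ℝ (Fin n ⊕ Fin n)) := rfl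
  rw [h1, ← Measure.map_map (by fun_prop) (by fun_prop), gaussInit, map_pi_eq_stdGaussian,
    IsGaussian.map_eq_gaussianReal, integral_strongDual_stdGaussian, variance_dual_stdGaussian,
    innerSL_apply_norm, hv]
  simp

/-- By rotation invariance the normalized inner product is a standard Gaussian. The strict
inequality makes the event empty for `v = 0`, so no lower bound on `‖v‖` is required. -/
theorem gaussInit_abs_inner_lt_le (v : EuclideanSpace ℝ (Fin n ⊕ Fin n)) (τ : ℝ) :
    gaussInit n {g | |inner ℝ v (WithLp.toLp 2 g)| < τ * ‖v‖} ≤ ENNReal.ofReal τ := by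
  rcases (norm_nonneg v).eq_or_lt with h | h
  · have hv : v = 0 := norm_eq_zero.1 h.symm
    simp [hv]
  have hu : ‖‖v‖⁻¹ • v‖ = 1 := by
    rw [norm_smul, norm_inv, norm_norm, inv_mul_cancel₀ h.ne']
  have hset : {g : Emb n | |inner ℝ v (WithLp.toLp 2 g)| < τ * ‖v‖} =
      (fun g => inner ℝ (‖v‖⁻¹ • v) (WithLp.toLp 2 g)) ⁻¹' {x | |x| < τ} := by
    ext g
    simp only [Set.mem_ofPred_eq, Set.mem_preimage, real_inner_smul_left, abs_mul, abs_inv, abs_norm]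
    rw [inv_mul_lt_iff₀ h, mul_comm]
  rw [hset, ← Measure.map_apply (by fun_prop) (measurableSet_lt (by fun_prop) (by fun_prop)),
    map_inner_gaussInit hu]
  exact gaussianReal_abs_lt_le τ

/-- Markov's inequality: each summand has mean one, so neither independence nor orthogonality is
involved. -/
theorem gaussInit_sum_inner_sq_le {ι : Type*} (J : Finset ι)
    (v : ι → EuclideanSpace ℝ (Fin n ⊕ Fin n)) (hv : ∀ i ∈ J, ‖v i‖ = 1) {M : ℝ} (hM : 0 < M) :
    gaussInit n {g | M ≤ ∑ i ∈ J, inner ℝ (v i) (WithLp.toLp 2 g) ^ 2} ≤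
      ENNReal.ofReal (J.card / M) := by
  have hmeas : ∀ i, Measurable fun g : Emb n =>
      ENNReal.ofReal (inner ℝ (v i) (WithLp.toLp 2 g) ^ 2) := fun i => by fun_prop
  have hsub : {g : Emb n | M ≤ ∑ i ∈ J, inner ℝ (v i) (WithLp.toLp 2 g) ^ 2} ⊆
      {g | ENNReal.ofReal M ≤ ∑ i ∈ J, ENNReal.ofReal (inner ℝ (v i) (WithLp.toLp 2 g) ^ 2)} := by
    intro g hg
    rw [Set.mem_ofPred_eq, ← ENNReal.ofReal_sum_of_nonneg fun i _ => sq_nonneg _]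
    exact ENNReal.ofReal_le_ofReal hg
  refine (measure_mono hsub).trans ((meas_ge_le_lintegral_div
    (Finset.measurable_sum _ fun i _ => hmeas i).aemeasurable (by simpa using hM)
    ENNReal.ofReal_ne_top).trans ?_)
  rw [lintegral_finsetSum _ fun i _ => hmeas i]
  have h1 : ∀ i ∈ J, ∫⁻ g, ENNReal.ofReal (inner ℝ (v i) (WithLp.toLp 2 g) ^ 2) ∂(gaussInit n) = 1 := by
    intro i hi
    have := lintegral_map (μ := gaussInit n) (f := fun x : ℝ => ENNReal.ofReal (x ^ 2))
      (g := fun g : Emb n => inner ℝ (v i) (WithLp.toLp 2 g)) (by fun_prop) (by fun_prop)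
    rw [map_inner_gaussInit (hv i hi), lintegral_sq_gaussianReal] at this
    exact this.symm
  rw [Finset.sum_congr rfl h1, ENNReal.ofReal_div_of_pos hM]
  simp

theorem gaussInit_norm_sq_le {M : ℝ} (hM : 0 < M) :
    gaussInit n {g | M ≤ ‖(WithLp.toLp 2 g : EuclideanSpace ℝ (Fin n ⊕ Fin n))‖ ^ 2} ≤
      ENNReal.ofReal (2 * n / M) := by
  have h := gaussInit_sum_inner_sq_le (n := n) Finset.univ
    (fun i => EuclideanSpace.basisFun (Fin n ⊕ Fin n) ℝ i)
    (fun i _ => (EuclideanSpace.basisFun (Fin n ⊕ Fin n) ℝ).orthonormal.norm_eq_one i) hM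
  simp_rw [← norm_sq_eq_sum_inner] at h
  convert h using 3
  simp [two_mul]

end Gaussian

/-! ### The deterministic run: stopping and recovery. -/

section Run

variable {n K : ℕ} {σ : Fin n → Fin K}

theorem toLp_iter_succ (C : Matrix (Fin n) (Fin n) ℝ) (η : ℝ) (g : Emb n) (t : ℕ) :
    (WithLp.toLp 2 (iter C η g (t + 1)) : EuclideanSpace ℝ (Fin n ⊕ Fin n)) =
      WithLp.toLp 2 (iter C η g t) + η • (offDiag (C * (1 - avgMat n))
        (WithLp.toLp 2 (iter C η g t)) +
          offDiag (gradErr C (iter C η g t)) (WithLp.toLp 2 (iter C η g t))) := by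
  rw [← toLp_step, iter, Function.iterate_succ_apply', iter]

theorem toLp_iter_zero (C : Matrix (Fin n) (Fin n) ℝ) (η : ℝ) (g : Emb n) :
    (WithLp.toLp 2 (iter C η g 0) : EuclideanSpace ℝ (Fin n ⊕ Fin n)) =
      (eps n / ‖(WithLp.toLp 2 g : EuclideanSpace ℝ (Fin n ⊕ Fin n))‖) • WithLp.toLp 2 g := by
  rw [iter, Function.iterate_zero_apply, l2_eq_norm, WithLp.toLp_smul]

theorem eps_nonneg (n : ℕ) : 0 ≤ eps n := by unfold eps; positivity

theorem norm_pairVec_meanDiff_sq (h : Balanced σ) (hK : 1 ≤ K) (hn : 1 ≤ n) {k l : Fin K}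
    (hkl : k ≠ l) : ‖pairVec (meanDiff σ k l) (meanDiff σ k l)‖ ^ 2 = 4 * K / n := by
  rw [norm_sq_halves]
  simp only [pairVec_inl, pairVec_inr, sum_meanDiff_sq h hK hn hkl]
  ring

theorem norm_pairVec_neg (x : Fin n → ℝ) : ‖pairVec x (-x)‖ = ‖pairVec x x‖ := by
  rw [← sq_eq_sq₀ (norm_nonneg _) (norm_nonneg _), norm_sq_halves, norm_sq_halves]
  simp

/-- Under a spectral splitting and a non-degenerate start, gradient descent stops within `t₁` steps
at an embedding that recovers the communities. -/
theorem stops_and_recovers (hσ : Balanced σ) (hK : 1 ≤ K) (hn : 1 ≤ n)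
    {C : Matrix (Fin n) (Fin n) ℝ} {η γ φ ν β τ err : ℝ} (hη : 0 ≤ η) (hγ : 0 ≤ γ) (hφ : 0 ≤ φ)
    (hν : 0 ≤ ν) (hβ : 0 ≤ β) (hτ : 0 < τ) (hτ1 : τ ≤ 1)
    {S : EuclideanSpace ℝ (Fin n ⊕ Fin n) →ₗ[ℝ] EuclideanSpace ℝ (Fin n ⊕ Fin n)}
    (hS : S.IsSymmetric) (hSS : ∀ u, S (S u) = S u)
    (hSH : ∀ u, S (offDiag (C * (1 - avgMat n)) u) = offDiag (C * (1 - avgMat n)) (S u))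
    (hgS : ∀ u, ‖offDiag (C * (1 - avgMat n)) (S u) - (2 * γ) • S u‖ ≤ φ * ‖S u‖)
    (hgN : ∀ u, ‖(u - S u) + η • offDiag (C * (1 - avgMat n)) (u - S u)‖ ≤
      (1 + η * φ) * ‖u - S u‖)
    (hBS : ∀ u, (offDiag (blockProj σ) u = 0 ∨ offDiag (blockProj σ) u = -u) →
      ‖S u‖ ≤ β * ‖u‖)
    (hN : ∀ w : Emb n, l2 w ≤ eps n * Del n →
      ‖offDiag (gradErr C w) (WithLp.toLp 2 w)‖ ≤ ν)
    {g : Emb n} {z : EuclideanSpace ℝ (Fin n ⊕ Fin n)}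
    (hz : z = S (WithLp.toLp 2 (iter C η g 0))) (hz0 : 0 < ‖z‖)
    (hg : ‖(WithLp.toLp 2 (iter C η g 0) : EuclideanSpace ℝ (Fin n ⊕ Fin n))‖ ≤ eps n)
    (hsep : ∀ k l, k ≠ l → τ ^ 2 / 2 * ‖z‖ * ‖pairVec (meanDiff σ k l) (meanDiff σ k l)‖ ≤
      |inner ℝ z (pairVec (meanDiff σ k l) (meanDiff σ k l))|)
    {t₁ : ℕ} (ht₁ : 1 ≤ t₁) (hA : t₁ * (2 * η * φ * eps n + η * ν) ≤ eps n)
    (hB : t₁ * (2 * η * φ * ‖z‖ + η * ν) ≤ τ ^ 2 / 4 * ‖z‖)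
    (hexit : eps n * Del n ≤ (1 + 2 * η * γ) ^ t₁ * (‖z‖ / 2)) (hΔ : 4 ≤ Del n)
    (hβτ : β + 2 * (4 / Del n) ≤ τ ^ 3 / 32) (herr : τ ^ 2 ≤ err) :
    ∃ tf ≤ t₁, StopsAt C η g tf ∧ RecoversFraction σ (iter C η g tf) err := by
  classical
  have hn0 : (0 : ℝ) < n := by exact_mod_cast hn
  have hK0 : (0 : ℝ) < K := by exact_mod_cast hK
  have hε0 : 0 ≤ eps n := eps_nonneg n
  have hτ2 : τ ^ 2 ≤ 1 := pow_le_one₀ hτ.le hτ1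
  have hτ3 : τ ^ 3 ≤ τ ^ 2 := pow_le_pow_of_le_one hτ.le hτ1 (by norm_num)
  set w : ℕ → EuclideanSpace ℝ (Fin n ⊕ Fin n) := fun t => WithLp.toLp 2 (iter C η g t) with hw
  set E : ℕ → EuclideanSpace ℝ (Fin n ⊕ Fin n) := fun t =>
    offDiag (gradErr C (iter C η g t)) (w t) with hE
  have hrec : ∀ t, w (t + 1) = w t + η • (offDiag (C * (1 - avgMat n)) (w t) + E t) :=
    fun t => toLp_iter_succ C η g t
  have hw0 : ‖w 0‖ ≤ eps n := hg
  have hz' : z = S (w 0) := hz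
  have hm1 : 1 ≤ 1 + 2 * η * γ := by linarith [mul_nonneg hη hγ]
  -- The stopping test starts at `t = 1`, so the initial point is covered separately by its norm, at
  -- most `ε ≤ ε Δ`.
  have hEbound : ∀ t, (1 ≤ t → l2 (iter C η g t) < eps n * Del n) → ‖E t‖ ≤ ν := by
    intro t ht
    refine hN _ ?_
    rcases Nat.eq_zero_or_pos t with rfl | h
    · rw [l2_eq_norm]
      exact hg.trans (le_mul_of_one_le_right hε0 (by linarith))
    · exact (ht h).le
  have hsig : ∀ t' ≤ t₁, (∀ t < t', ‖E t‖ ≤ ν) →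
      ‖S (w t') - (1 + 2 * η * γ) ^ t' • z‖ ≤ (1 + 2 * η * γ) ^ t' * (τ ^ 2 / 4 * ‖z‖) := by
    intro t' ht' hEt
    have hmono : (t' : ℝ) * (2 * η * φ * ‖z‖ + η * ν) ≤ t₁ * (2 * η * φ * ‖z‖ + η * ν) :=
      mul_le_mul_of_nonneg_right (by exact_mod_cast ht') (by positivity)
    have h := signal_bound hS hSS hSH hη hγ hφ hν hgS hrec hEt (t₁ := t') (by
      rw [← hz']
      refine (hmono.trans hB).trans ?_
      nlinarith) t' le_rfl
    rw [← hz'] at h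
    exact h.trans (mul_le_mul_of_nonneg_left (hmono.trans hB) (by positivity))
  -- Without an exit the nonlinear error stays below `ν` up to `t₁`, so the signal there is at least
  -- `3/4` of its ideal value, while half of that value already reaches `ε Δ`.
  have hex : ∃ s, 1 ≤ s ∧ s ≤ t₁ ∧ eps n * Del n ≤ l2 (iter C η g s) := by
    by_contra! hcon
    have h1 := hsig t₁ le_rfl fun t ht => hEbound t fun h => hcon t h ht.le
    have h2 := hcon t₁ ht₁ le_rfl
    rw [l2_eq_norm] at h2
    have h3 : ‖S (w t₁)‖ ≤ ‖w t₁‖ := norm_proj_le hS hSS _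
    have h4 : ‖(1 + 2 * η * γ) ^ t₁ • z‖ ≤ ‖S (w t₁) - (1 + 2 * η * γ) ^ t₁ • z‖ + ‖S (w t₁)‖ := by
      rw [norm_sub_rev]
      simpa using norm_add_le ((1 + 2 * η * γ) ^ t₁ • z - S (w t₁)) (S (w t₁))
    rw [norm_smul, Real.norm_of_nonneg (by positivity)] at h4
    have h5 : (1 + 2 * η * γ) ^ t₁ * (τ ^ 2 / 4 * ‖z‖) ≤ (1 + 2 * η * γ) ^ t₁ * (1 / 4 * ‖z‖) := by
      gcongr
    have h6 : 0 ≤ (1 + 2 * η * γ) ^ t₁ * ‖z‖ := by positivity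
    change ‖w t₁‖ < _ at h2
    linarith
  have hexs : ∃ s, 1 ≤ s ∧ eps n * Del n ≤ l2 (iter C η g s) :=
    hex.imp fun s hs => ⟨hs.1, hs.2.2⟩
  set tf := Nat.find hexs with htf
  have hspec := Nat.find_spec hexs
  have htf1 : tf ≤ t₁ := by
    obtain ⟨s, hs1, hs2, hs3⟩ := hex
    exact (Nat.find_min' hexs ⟨hs1, hs3⟩).trans hs2
  have hEt : ∀ t < tf, ‖E t‖ ≤ ν := fun t ht => hEbound t fun h =>
    not_le.1 fun hle => Nat.find_min hexs ht ⟨h, hle⟩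
  refine ⟨tf, htf1, ⟨hspec, fun s hs => Nat.find_min' hexs hs⟩, ?_⟩
  have hsigf := hsig tf htf1 hEt
  have hmonoA : (tf : ℝ) * (2 * η * φ * eps n + η * ν) ≤ t₁ * (2 * η * φ * eps n + η * ν) :=
    mul_le_mul_of_nonneg_right (by exact_mod_cast htf1) (by positivity)
  have hnoise : ‖w tf - S (w tf)‖ ≤ 2 * eps n := by
    have h := noise_bound hS hSS hSH hη hφ hν hε0 hgN hrec hw0 hEt (hmonoA.trans hA) tf le_rfl
    linarith
  have hwtf : eps n * Del n ≤ ‖w tf‖ := by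
    have := hspec.2
    rwa [l2_eq_norm] at this
  have hεpos : 0 < eps n := by unfold eps; positivity
  have hSw : eps n * Del n / 2 ≤ ‖S (w tf)‖ := by
    have h1 : ‖w tf‖ ≤ ‖w tf - S (w tf)‖ + ‖S (w tf)‖ := by
      simpa using norm_add_le (w tf - S (w tf)) (S (w tf))
    have h2 : eps n * 4 ≤ eps n * Del n := mul_le_mul_of_nonneg_left hΔ hε0
    linarith
  have hΔ0 : 0 < Del n := by linarith
  have hSw0 : 0 < ‖S (w tf)‖ := lt_of_lt_of_le (by positivity) hSw
  -- Noise at most `2ε` against signal at least `εΔ/2`.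
  have hζ : ‖w tf - S (w tf)‖ ≤ 4 / Del n * ‖S (w tf)‖ := by
    refine hnoise.trans ?_
    calc 2 * eps n = 4 / Del n * (eps n * Del n / 2) := by field_simp; ring
      _ ≤ 4 / Del n * ‖S (w tf)‖ := by gcongr
  have hζ0 : 0 ≤ 4 / Del n := by positivity
  set D : ℝ := √(4 * K / n) with hD
  have hDpos : 0 < D := Real.sqrt_pos.2 (by positivity)
  have hDsq : D ^ 2 = 4 * K / n := Real.sq_sqrt (by positivity)
  have hnd : ∀ k l, k ≠ l → ‖pairVec (meanDiff σ k l) (meanDiff σ k l)‖ = D := fun k l hkl => by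
    rw [hD, ← norm_pairVec_meanDiff_sq hσ hK hn hkl, Real.sqrt_sq (norm_nonneg _)]
  -- This is the conclusion of `separation_bound` with `ω = τ²/2`; then `θ = τ²/4` is exactly `ω/2`.
  refine recoversFraction_of_bounds hσ hK (s := ‖S (w tf)‖ * D * (τ ^ 2 / 2 / 16)) (by positivity)
    ?_ ?_
  · intro k l hkl
    rw [← inner_meanDiff hσ hK, ← hnd k l hkl]
    refine separation_bound hS (m := (1 + 2 * η * γ) ^ tf) (θ := τ ^ 2 / 4) (β := β)
      (ζ := 4 / Del n) (d' := pairVec (meanDiff σ k l) (-meanDiff σ k l)) (by positivity) hsigf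
      (by linarith) (by linarith) (hsep k l hkl) hSS
      (hBS _ (Or.inr (offDiag_blockProj_meanDiff_neg hσ hK hn k l))) (norm_pairVec_neg _) ?_ hζ
      (by linarith)
    refine ext_halves (fun i => ?_) fun i => ?_ <;> simp [two_mul]
  · have h1 := deviation_bound hS hβ hζ0 hSS (inner_meanDev hσ hK hn (iter C η g tf))
      (hBS _ (Or.inl (offDiag_blockProj_meanDev hσ hK hn _))) hζ
    have h2 := pow_le_pow_left₀ (norm_nonneg _) h1 2
    rw [norm_sq_halves] at h2
    simp only [pairVec_inl, pairVec_inr, Pi.zero_apply, ne_eq, OfNat.ofNat_ne_zero,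
      not_false_eq_true, zero_pow, Finset.sum_const_zero, add_zero] at h2
    refine h2.trans ?_
    have h3 : (β + 4 / Del n) * ‖S (w tf)‖ ≤ τ ^ 3 / 32 * ‖S (w tf)‖ :=
      mul_le_mul_of_nonneg_right (by linarith) (norm_nonneg _)
    refine (pow_le_pow_left₀ (by positivity) h3 2).trans ?_
    have h4 : err * (n / K) * (‖S (w tf)‖ * D * (τ ^ 2 / 2 / 16) / 2) ^ 2 =
        err * (τ ^ 4 * ‖S (w tf)‖ ^ 2 / 1024) := by
      have : (‖S (w tf)‖ * D * (τ ^ 2 / 2 / 16) / 2) ^ 2 =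
        ‖S (w tf)‖ ^ 2 * D ^ 2 * τ ^ 4 / 4096 := by ring
      rw [this, hDsq]
      field_simp
      ring
    rw [h4]
    calc (τ ^ 3 / 32 * ‖S (w tf)‖) ^ 2 = τ ^ 2 * (τ ^ 4 * ‖S (w tf)‖ ^ 2 / 1024) := by ring
      _ ≤ err * (τ ^ 4 * ‖S (w tf)‖ ^ 2 / 1024) := by gcongr

end Run

/-! ### The order of magnitude `1/n` of `γ`. -/

section Constants

variable {n K T L : ℕ}

theorem windowMass_nonneg (hTL : T < L) : 0 ≤ windowMass T L := by
  refine Finset.sum_nonneg fun t ht => ?_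
  have : (t : ℝ) ≤ L := by exact_mod_cast (Finset.mem_Icc.1 ht).2.trans hTL.le
  linarith

/-- The ratio increases with `p`, and `p = (1 + δ) q` gives the lower bound. -/
theorem walkRatio_bounds (hK : 2 ≤ K) {p q δ : ℝ} (hq : 0 < q) (hδ : 0 < δ)
    (hpq : (1 + δ) * q ≤ p) : δ / (K + δ) ≤ walkRatio K p q ∧ walkRatio K p q ≤ 1 := by
  have hK' : (2 : ℝ) ≤ K := by exact_mod_cast hK
  have hp : 0 < p := lt_of_lt_of_le (by positivity) hpq
  have hden : 0 < p + ((K : ℝ) - 1) * q := by nlinarith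
  rw [walkRatio]
  constructor
  · rw [div_le_div_iff₀ (by positivity) hden]
    nlinarith
  · rw [div_le_one hden]
    nlinarith

/-- The term `t = 1` alone suffices from below since `L - 1 ≥ 1`; from above each term is at most
`L`. -/
theorem gam_bounds (hK : 2 ≤ K) (hT : 1 ≤ T) (hTL : T < L) (hn : 1 ≤ n) {p q δ : ℝ} (hq : 0 < q)
    (hδ : 0 < δ) (hpq : (1 + δ) * q ≤ p) :
    δ / (K + δ) / n ≤ gam n K T L p q ∧ gam n K T L p q ≤ T * L / n := by
  obtain ⟨h1, h2⟩ := walkRatio_bounds hK hq hδ hpq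
  have hr : 0 ≤ walkRatio K p q := le_trans (by positivity) h1
  have hL : ∀ t ∈ Finset.Icc 1 T, (t : ℝ) + 1 ≤ L := fun t ht => by
    exact_mod_cast Nat.succ_le_of_lt ((Finset.mem_Icc.1 ht).2.trans_lt hTL)
  rw [gam_eq T L p q (by omega) hn]
  constructor
  · refine div_le_div_of_nonneg_right ?_ (Nat.cast_nonneg n)
    refine le_trans ?_ (Finset.single_le_sum
      (f := fun t : ℕ => ((L : ℝ) - t) * walkRatio K p q ^ t) (fun t ht => ?_)
      (Finset.mem_Icc.2 ⟨le_rfl, hT⟩))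
    · have := hL 1 (Finset.mem_Icc.2 ⟨le_rfl, hT⟩)
      push_cast at this ⊢
      rw [pow_one]
      nlinarith
    · have := hL t ht
      exact mul_nonneg (by linarith) (pow_nonneg hr t)
  · refine div_le_div_of_nonneg_right ?_ (Nat.cast_nonneg n)
    refine (Finset.sum_le_sum (g := fun _ => (L : ℝ)) fun t ht => ?_).trans_eq (by simp)
    have := hL t ht
    have h3 : walkRatio K p q ^ t ≤ 1 := pow_le_one₀ hr h2
    have h4 : 0 ≤ walkRatio K p q ^ t := pow_nonneg hr t
    have h5 : (0 : ℝ) ≤ t := Nat.cast_nonneg t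
    nlinarith

end Constants

/-! ### Comparing `C` with the expected block form. -/

section Perturbation

variable {n K : ℕ} {σ : Fin n → Fin K}

/-- Right multiplication by `1 - J/n` removes the averaging term of `Cbar`, preserves `Π`, and does
not increase the norm of the remainder. -/
theorem offDiag_sub_le (h : Balanced σ) (hK : 1 ≤ K) (hn : 1 ≤ n) {C Cbar : Matrix (Fin n) (Fin n) ℝ}
    {a γ : ℝ} (hC : Cbar = a • avgMat n + (2 * γ) • blockProj σ)
    (v : EuclideanSpace ℝ (Fin n ⊕ Fin n)) :
    ‖offDiag (C * (1 - avgMat n)) v - (2 * γ) • offDiag (blockProj σ) v‖ ≤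
      specNorm (C - Cbar) * ‖v‖ := by
  have h1 : Cbar * (1 - avgMat n) = (2 * γ) • blockProj σ := by
    rw [hC, add_mul, smul_mul_assoc, smul_mul_assoc, mul_sub, mul_sub, avgMat_mul_self hn,
      blockProj_mul_avgMat h hK hn]
    simp
  have h2 : C * (1 - avgMat n) = (C - Cbar) * (1 - avgMat n) + (2 * γ) • blockProj σ := by
    rw [← h1, ← add_mul, sub_add_cancel]
  rw [h2, offDiag_add, offDiag_smul, LinearMap.add_apply, LinearMap.smul_apply, add_sub_cancel_right]
  refine (norm_offDiag_le _ _).trans (mul_le_mul_of_nonneg_right ?_ (norm_nonneg _))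
  refine (specNorm_mul_le _ _).trans ?_
  exact mul_le_of_le_one_right (specNorm_nonneg _) (specNorm_one_sub_avgMat_le hn)

theorem deg_blockForm (h : Balanced σ) (hK : 1 ≤ K) (hn : 1 ≤ n) (a b : ℝ) (i : Fin n) :
    deg (a • avgMat n + b • blockProj σ) i = a := by
  have hn0 : (n : ℝ) ≠ 0 := by positivity
  have hK0 : (K : ℝ) ≠ 0 := by positivity
  have h1 : ∑ j, blockProj σ i j = 0 := by
    have := sum_blockProj σ (fun _ => 1) i
    simp only [mul_one] at this
    rw [this]
    simp [h.card_eq hK]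
    field_simp
    simp
  simp [deg, Finset.sum_add_distrib, ← Finset.mul_sum, h1, avgMat]
  field_simp

end Perturbation

/-! ### All quantities as powers of `r = n^(1/36)`; a spare factor `r` absorbs logarithms and
constants. -/

section Scale

variable {n : ℕ}

/-- The scale `n^(1/36)`, of which `n`, `ε` and `Δ` are powers. -/
def scale (n : ℕ) : ℝ := (n : ℝ) ^ (1 / 36 : ℝ)

theorem scale_pow (n m : ℕ) : scale n ^ m = (n : ℝ) ^ ((m : ℝ) / 36) := by
  rw [scale, ← Real.rpow_natCast, ← Real.rpow_mul (Nat.cast_nonneg n)]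
  ring_nf

theorem natCast_eq_scale (n : ℕ) : (n : ℝ) = scale n ^ 36 := by
  rw [scale_pow]; norm_num

theorem Del_eq_scale (n : ℕ) : Del n = scale n ^ 6 := by
  rw [scale_pow, Del]; norm_num

theorem eps_eq_scale (n : ℕ) : eps n = (scale n ^ 24)⁻¹ := by
  rw [scale_pow, eps, ← Real.rpow_neg (Nat.cast_nonneg n)]; norm_num

theorem sqrt_eq_scale (n : ℕ) : √(n : ℝ) = scale n ^ 18 := by
  rw [scale_pow, Real.sqrt_eq_rpow]; norm_num

/-- The condition `ρ > 1/3` gives `(ρ + 2)/2 ≥ 7/6 = 42/36`. As `r^42 = n Δ`, the perturbation is a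
factor `Δ` below the order `1/n` of `γ`. -/
theorem errorBound_le {ρ c : ℝ} (hρ : 1 / 3 < ρ) (hc : 0 < c) (hn : 1 ≤ n) :
    c / √((n : ℝ) ^ (ρ + 2)) ≤ c / scale n ^ 42 := by
  have hn1 : (1 : ℝ) ≤ n := by exact_mod_cast hn
  have h : scale n ^ 42 ≤ √((n : ℝ) ^ (ρ + 2)) := by
    rw [scale_pow]
    refine Real.le_sqrt_of_sq_le ?_
    rw [← Real.rpow_natCast, ← Real.rpow_mul (Nat.cast_nonneg n)]
    refine Real.rpow_le_rpow_of_exponent_le hn1 ?_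
    push_cast
    linarith
  have h0 : 0 < scale n ^ 42 := by rw [scale_pow]; positivity
  exact div_le_div_of_nonneg_left hc.le h0 h

theorem tendsto_scale : Tendsto scale atTop atTop :=
  (tendsto_rpow_atTop (by norm_num)).comp tendsto_natCast_atTop_atTop

/-- Four factors `r^(-18)` arise: three from `‖w‖³` with `‖w‖ ≤ ε Δ`, and one from `1/√n`. -/
theorem norm_gradErr_apply_le (hn : 1 ≤ n) {C : Matrix (Fin n) (Fin n) ℝ} {D : ℝ} (hD : 0 ≤ D)
    (hdeg : ∀ i, |deg C i| ≤ D) (hs : 2 ≤ scale n) {w : Emb n} (hw : l2 w ≤ eps n * Del n) :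
    ‖offDiag (gradErr C w) (WithLp.toLp 2 w)‖ ≤ 4 * D / scale n ^ 72 := by
  set r := scale n with hr
  have hr0 : 0 < r := by linarith
  have hl0 : 0 ≤ l2 w := Real.sqrt_nonneg _
  have hw' : l2 w ≤ (r ^ 18)⁻¹ := by
    refine hw.trans_eq ?_
    rw [eps_eq_scale, Del_eq_scale, ← hr]
    field_simp
  have hw2 : l2 w ^ 2 ≤ ((r ^ 18)⁻¹) ^ 2 := pow_le_pow_left₀ hl0 hw' 2
  have hhalf : ((r ^ 18)⁻¹) ^ 2 ≤ 1 / 2 := by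
    rw [← inv_pow, ← pow_mul, inv_pow, one_div]
    refine inv_anti₀ (by norm_num) (hs.trans (le_self_pow₀ (by linarith) (by norm_num)))
  refine (norm_offDiag_le _ _).trans ?_
  rw [← l2_eq_norm]
  refine (mul_le_mul (specNorm_gradErr_le hn hD hdeg w (hw2.trans hhalf)) hw' hl0
    (by positivity)).trans ?_
  rw [sqrt_eq_scale, ← hr]
  calc 4 * D * l2 w ^ 2 / r ^ 18 * (r ^ 18)⁻¹ ≤
      4 * D * ((r ^ 18)⁻¹) ^ 2 / r ^ 18 * (r ^ 18)⁻¹ := by gcongr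
    _ = 4 * D / r ^ 72 := by field_simp

end Scale

/-! ### The normalized starting point. -/

section Init

variable {n : ℕ}

/-- The normalized start inherits the non-degeneracy of the Gaussian vector. -/
theorem init_bounds {S : EuclideanSpace ℝ (Fin n ⊕ Fin n) →ₗ[ℝ] EuclideanSpace ℝ (Fin n ⊕ Fin n)}
    (hS : S.IsSymmetric) (hSS : ∀ u, S (S u) = S u) (C : Matrix (Fin n) (Fin n) ℝ) (η : ℝ)
    (hs : 0 < scale n) {g : Emb n}
    (h1 : ‖S (WithLp.toLp 2 g)‖ ^ 2 ≤ scale n ^ 2)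
    (h2 : ‖(WithLp.toLp 2 g : EuclideanSpace ℝ (Fin n ⊕ Fin n))‖ ^ 2 ≤ 2 * n * scale n ^ 2)
    {d : EuclideanSpace ℝ (Fin n ⊕ Fin n)} (hd : 0 < ‖d‖) (hSd : ‖d - S d‖ ≤ 1 / 2 * ‖d‖)
    (h3 : (scale n)⁻¹ * ‖S d‖ ≤ |inner ℝ (S d) (WithLp.toLp 2 g)|) :
    ‖(WithLp.toLp 2 (iter C η g 0) : EuclideanSpace ℝ (Fin n ⊕ Fin n))‖ ≤ eps n ∧
    (scale n ^ 44)⁻¹ / 2 ≤ ‖S (WithLp.toLp 2 (iter C η g 0))‖ ∧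
    (scale n)⁻¹ ^ 2 / 2 * ‖S (WithLp.toLp 2 (iter C η g 0))‖ * ‖d‖ ≤
      |inner ℝ (S (WithLp.toLp 2 (iter C η g 0))) d| := by
  set r := scale n with hr
  rw [toLp_iter_zero]
  set G : EuclideanSpace ℝ (Fin n ⊕ Fin n) := WithLp.toLp 2 g with hG
  have hSd' : ‖d‖ / 2 ≤ ‖S d‖ := by
    have : ‖d‖ ≤ ‖d - S d‖ + ‖S d‖ := by simpa using norm_add_le (d - S d) (S d)
    linarith
  have hSd0 : 0 < ‖S d‖ := lt_of_lt_of_le (by positivity) hSd'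
  -- Anticoncentration along a single direction in the range of `S` already bounds the whole
  -- projection from below.
  have hSG : r⁻¹ ≤ ‖S G‖ := by
    have h4 : |inner ℝ (S d) G| ≤ ‖S d‖ * ‖S G‖ := by
      have : inner ℝ (S d) G = inner ℝ (S d) (S G) := by rw [← hS, hSS]
      rw [this]
      exact abs_real_inner_le_norm _ _
    have h5 := h3.trans h4
    rw [mul_comm] at h5
    exact le_of_mul_le_mul_left h5 hSd0
  have hSG0 : 0 < ‖S G‖ := lt_of_lt_of_le (by positivity) hSG
  have hG0 : 0 < ‖G‖ := hSG0.trans_le (norm_proj_le hS hSS _)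
  have hSGr : ‖S G‖ ≤ r := le_of_sq_le_sq h1 hs.le
  have hGr : ‖G‖ ≤ 2 * r ^ 19 := by
    refine le_of_sq_le_sq (h2.trans ?_) (by positivity)
    rw [natCast_eq_scale, ← hr]
    have : 0 ≤ r ^ 38 := by positivity
    nlinarith
  have hε : 0 < eps n := by rw [eps_eq_scale]; positivity
  have hc0 : 0 ≤ eps n / ‖G‖ := by positivity
  have hnS : ‖S ((eps n / ‖G‖) • G)‖ = eps n / ‖G‖ * ‖S G‖ := by
    rw [map_smul, norm_smul, Real.norm_of_nonneg hc0]
  refine ⟨?_, ?_, ?_⟩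
  · rw [norm_smul, Real.norm_of_nonneg hc0, div_mul_cancel₀ _ hG0.ne']
  · rw [hnS]
    calc (r ^ 44)⁻¹ / 2 = eps n / (2 * r ^ 19) * r⁻¹ := by
          rw [eps_eq_scale, ← hr]; field_simp
      _ ≤ eps n / ‖G‖ * ‖S G‖ := by gcongr
  · rw [hnS, map_smul, real_inner_smul_left, abs_mul, abs_of_nonneg hc0]
    have e : inner ℝ (S G) d = inner ℝ (S d) G := by rw [hS, real_inner_comm]
    rw [e]
    have h6 : r⁻¹ * ‖S G‖ ≤ 1 := by
      rw [inv_mul_le_iff₀ hs]; linarith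
    calc r⁻¹ ^ 2 / 2 * (eps n / ‖G‖ * ‖S G‖) * ‖d‖ =
          eps n / ‖G‖ * (r⁻¹ * ‖S G‖) * (r⁻¹ * (‖d‖ / 2)) := by ring
      _ ≤ eps n / ‖G‖ * 1 * (r⁻¹ * ‖S d‖) := by gcongr
      _ ≤ eps n / ‖G‖ * |inner ℝ (S d) G| := by rw [mul_one]; gcongr

end Init

/-! ### The choice of the time horizon. -/

section Horizon

/-- A number of steps below the claimed bound within which the signal outgrows `ε Δ` while all
errors stay negligible. -/
theorem exists_horizon {r b k η γ φ ν : ℝ} (hr : 7680 ≤ r) (hb : 7680 * b ≤ r) (hk : 7680 * k ≤ r)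
    (hη : 0 < η) (hγ : 0 < γ) (hηγ : 3 * (η * γ) ≤ 1) (hφ : φ ≤ b / r ^ 6 * γ)
    (hν : ν ≤ 4 * k / r ^ 60 * γ) :
    ∃ t : ℕ, 1 ≤ t ∧ (t : ℝ) < 4 * Real.log (r ^ 30) / (η * γ) ∧
      t * (2 * η * φ * (r ^ 24)⁻¹ + η * ν) ≤ (r ^ 24)⁻¹ ∧
      ∀ z, (r ^ 44)⁻¹ / 2 ≤ z → t * (2 * η * φ * z + η * ν) ≤ r⁻¹ ^ 2 / 4 * z ∧
        (r ^ 24)⁻¹ * r ^ 6 ≤ (1 + 2 * η * γ) ^ t * (z / 2) := by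
  have hr0 : 0 < r := by linarith
  have hr1 : 1 ≤ r := by linarith
  have hηγ0 : 0 < η * γ := mul_pos hη hγ
  have hlog1 : 1 ≤ Real.log r := by
    rw [Real.le_log_iff_exp_le hr0]
    linarith [Real.exp_one_lt_d9]
  have hlogr : Real.log r ≤ r := (Real.log_le_sub_one_of_pos hr0).trans (by linarith)
  have hlog : Real.log (r ^ 30) = 30 * Real.log r := by rw [Real.log_pow]; norm_num
  set M := 4 * Real.log (r ^ 30) / (η * γ) with hM
  have hMeq : M * (η * γ) = 120 * Real.log r := by
    rw [hM, hlog, div_mul_cancel₀ _ hηγ0.ne']; ring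
  have hM2 : 2 < M := by
    by_contra! hle
    have := mul_le_mul_of_nonneg_right hle hηγ0.le
    linarith
  have htu := Nat.ceil_lt_add_one (a := M / 2) (by linarith)
  have htl := Nat.le_ceil (M / 2)
  -- Half of the claimed bound leaves room for rounding up and still gives `t η γ ≥ 60 log r`.
  set t := ⌈M / 2⌉₊ with ht
  have htM : (t : ℝ) < M := by linarith
  have ht0 : (0 : ℝ) ≤ t := Nat.cast_nonneg t
  -- The logarithm costs one power of `r`; the constant `7680 = 64 · 120` then absorbs the factor
  -- `120`.
  have hX : t * η * γ ≤ 120 * r := by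
    have := mul_le_mul_of_nonneg_right htM.le hηγ0.le
    rw [hMeq, ← mul_assoc] at this
    linarith
  have htη : 0 ≤ t * η := by positivity
  have hXφ : t * η * φ ≤ 1 / 64 * (r ^ 4)⁻¹ := by
    rcases le_or_gt b 0 with hb0 | hb0
    · have h1 : φ ≤ 0 := hφ.trans (mul_nonpos_of_nonpos_of_nonneg
        (div_nonpos_of_nonpos_of_nonneg hb0 (by positivity)) hγ.le)
      exact (mul_nonpos_of_nonneg_of_nonpos htη h1).trans (by positivity)
    calc t * η * φ ≤ t * η * (b / r ^ 6 * γ) := by gcongr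
      _ = t * η * γ * (b / r ^ 6) := by ring
      _ ≤ 120 * r * (b / r ^ 6) := by gcongr
      _ = 7680 * b / 64 / r ^ 5 := by field_simp; norm_num
      _ ≤ r / 64 / r ^ 5 := by gcongr
      _ = 1 / 64 * (r ^ 4)⁻¹ := by field_simp
  have hXν : t * η * ν ≤ 1 / 16 * (r ^ 58)⁻¹ := by
    rcases le_or_gt k 0 with hk0 | hk0
    · have h1 : ν ≤ 0 := hν.trans (mul_nonpos_of_nonpos_of_nonneg
        (div_nonpos_of_nonpos_of_nonneg (by linarith) (by positivity)) hγ.le)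
      exact (mul_nonpos_of_nonneg_of_nonpos htη h1).trans (by positivity)
    calc t * η * ν ≤ t * η * (4 * k / r ^ 60 * γ) := by gcongr
      _ = t * η * γ * (4 * k / r ^ 60) := by ring
      _ ≤ 120 * r * (4 * k / r ^ 60) := by gcongr
      _ = 7680 * k / 16 / r ^ 59 := by field_simp; norm_num
      _ ≤ r / 16 / r ^ 59 := by gcongr
      _ = 1 / 16 * (r ^ 58)⁻¹ := by field_simp
  have hpow : ∀ {i j : ℕ}, i ≤ j → (r ^ j)⁻¹ ≤ (r ^ i)⁻¹ := fun {i j} hij =>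
    inv_anti₀ (by positivity) (pow_le_pow_right₀ hr1 hij)
  refine ⟨t, Nat.one_le_ceil_iff.2 (by linarith), htM, ?_, fun z hz => ⟨?_, ?_⟩⟩
  · have h1 : t * η * φ * (r ^ 24)⁻¹ ≤ 1 / 64 * (r ^ 24)⁻¹ := by
      refine mul_le_mul_of_nonneg_right (hXφ.trans ?_) (by positivity)
      have := hpow (i := 0) (j := 4) (by norm_num)
      simp only [pow_zero, inv_one] at this
      linarith
    have h2 := hpow (i := 24) (j := 58) (by norm_num)
    have h3 : 0 < (r ^ 24)⁻¹ := by positivity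
    linarith
  · have hz0 : 0 < z := lt_of_lt_of_le (by positivity) hz
    have h1 : t * η * φ * z ≤ 1 / 64 * (r ^ 2)⁻¹ * z := by
      refine mul_le_mul_of_nonneg_right (hXφ.trans ?_) hz0.le
      linarith [hpow (i := 2) (j := 4) (by norm_num)]
    have h2 : (r ^ 58)⁻¹ ≤ (r ^ 2)⁻¹ * (2 * z) := by
      calc (r ^ 58)⁻¹ ≤ (r ^ 46)⁻¹ := hpow (by norm_num)
        _ = (r ^ 2)⁻¹ * (2 * ((r ^ 44)⁻¹ / 2)) := by field_simp
        _ ≤ (r ^ 2)⁻¹ * (2 * z) := by gcongr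
    rw [inv_pow]
    have h3 : 0 < (r ^ 2)⁻¹ * z := by positivity
    linarith
  · have hz0 : 0 < z := lt_of_lt_of_le (by positivity) hz
    have hexp : Real.exp (η * γ) ≤ 1 + 2 * η * γ := by
      have := Real.abs_exp_sub_one_le (x := η * γ) (by rw [abs_of_pos hηγ0]; linarith)
      rw [abs_of_pos hηγ0] at this
      linarith [(abs_le.1 this).2]
    -- Starting from `r^(-44)/2`, a gain of `r^60` passes the threshold `ε Δ = r^(-18)` with the
    -- factor `r^34 / 4` to spare.
    have hgrow : r ^ 60 ≤ (1 + 2 * η * γ) ^ t := by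
      calc r ^ 60 = Real.exp (60 * Real.log r) := by
            rw [← Real.exp_log (pow_pos hr0 60), Real.log_pow]; norm_num
        _ ≤ Real.exp (t * (η * γ)) := by
            refine Real.exp_le_exp.2 ?_
            have := mul_le_mul_of_nonneg_right htl hηγ0.le
            linarith
        _ = Real.exp (η * γ) ^ t := by rw [← Real.exp_nat_mul]
        _ ≤ (1 + 2 * η * γ) ^ t := by gcongr
    have h16 : (1 : ℝ) ≤ r ^ 34 / 4 := by
      have : r ≤ r ^ 34 := le_self_pow₀ hr1 (by norm_num)
      linarith
    calc (r ^ 24)⁻¹ * r ^ 6 = (r ^ 18)⁻¹ * 1 := by field_simp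
      _ ≤ (r ^ 18)⁻¹ * (r ^ 34 / 4) := by gcongr
      _ = r ^ 60 * ((r ^ 44)⁻¹ / 2 / 2) := by field_simp; norm_num
      _ ≤ (1 + 2 * η * γ) ^ t * (z / 2) := by gcongr

end Horizon

/-! ### Union bound over the bad initializations. -/

section Failure

variable {n K : ℕ} {σ : Fin n → Fin K}

/-- The failure probability of gradient descent on a small perturbation of a block matrix. -/
theorem failure_le (hσ : Balanced σ) (hK : 2 ≤ K) (hn : 1 ≤ n) {C : Matrix (Fin n) (Fin n) ℝ}
    {κ γ φ b k η : ℝ} (hκ : 0 ≤ κ) (hγ : 0 < γ) (hη : 0 < η)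
    (hr : 7680 * (b + 1) ≤ scale n) (hb0 : 0 ≤ b) (hk : 7680 * k ≤ scale n)
    (hηγ : 3 * (η * γ) ≤ 1) (hφ : φ ≤ b / scale n ^ 6 * γ)
    (hκφ : κ / n + φ * √n ≤ k / scale n ^ 24 * (scale n ^ 36 * γ))
    (hR : specNorm (C - ((κ / n) • avgMat n + (2 * γ) • blockProj σ)) ≤ φ) :
    gaussInit n {g | ¬ ∃ tf : ℕ, StopsAt C η g tf ∧
        (tf : ℝ) < 4 * Real.log (n / Del n) / (η * γ) ∧
        RecoversFraction σ (iter C η g tf) (((K : ℝ) ^ 2 + 4 * K + 1) * (scale n)⁻¹)} ≤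
      ENNReal.ofReal (((K : ℝ) ^ 2 + 4 * K + 1) * (scale n)⁻¹) := by
  classical
  set r := scale n with hrdef
  have hK1 : 1 ≤ K := by omega
  have hn0 : (0 : ℝ) < n := by exact_mod_cast hn
  have hK0 : (0 : ℝ) < K := by exact_mod_cast hK1
  have hr1 : 7680 ≤ r := by linarith
  have hr0 : 0 < r := by linarith
  have hφ0 : 0 ≤ φ := (specNorm_nonneg _).trans hR
  have hpow : ∀ m : ℕ, m ≠ 0 → r ≤ r ^ m := fun m hm => le_self_pow₀ (by linarith) hm
  have hbr : b / r ^ 6 ≤ 1 / 2 := by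
    rw [div_le_iff₀ (by positivity)]
    have := hpow 6 (by norm_num)
    linarith
  have hβ : φ / γ ≤ b / r ^ 6 := (div_le_iff₀ hγ).2 hφ
  have hφγ : φ ≤ γ / 2 := by nlinarith
  set Cbar := (κ / n) • avgMat n + (2 * γ) • blockProj σ with hCbar
  obtain ⟨S, J, hS, hSS, hSH, hgS, hgN, hB1, hB0, hJ, hJ1, hJc⟩ :=
    exists_spectral_split (offDiag_isSymmetric (C * (1 - avgMat n)))
      (offDiag_isSymmetric (blockProj σ))
      (offDiag_tripotent (blockProj_transpose σ) (blockProj_mul_self hσ hK1 hn)) hγ hφ0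
      (by nlinarith) fun v => (offDiag_sub_le hσ hK1 hn hCbar v).trans
        (mul_le_mul_of_nonneg_right hR (norm_nonneg _))
  rw [trace_offDiag_sq (blockProj_transpose σ) (blockProj_mul_self hσ hK1 hn),
    trace_blockProj σ hn] at hJc
  have hdeg : ∀ i, |deg C i| ≤ κ / n + φ * √n := fun i => by
    have h1 : C = Cbar + (C - Cbar) := by abel
    rw [h1, deg_add, hCbar, deg_blockForm hσ hK1 hn, ← hCbar]
    refine (abs_add_le _ _).trans (add_le_add (abs_of_nonneg (by positivity)).le ?_)
    exact (abs_deg_le _ _).trans (mul_le_mul_of_nonneg_right hR (Real.sqrt_nonneg _))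
  have hD0 : 0 ≤ κ / n + φ * √n := by positivity
  set ν := 4 * (κ / n + φ * √n) / r ^ 72 with hν
  have hνle : ν ≤ 4 * k / r ^ 60 * γ := by
    calc ν ≤ 4 * (k / r ^ 24 * (r ^ 36 * γ)) / r ^ 72 := by rw [hν]; gcongr
      _ = 4 * k / r ^ 60 * γ := by field_simp
  obtain ⟨t₁, ht1, htM, hA, hz⟩ := exists_horizon hr1 (by linarith) hk hη hγ hηγ hφ hνle
  have hlogeq : (n : ℝ) / Del n = r ^ 30 := by
    rw [natCast_eq_scale, Del_eq_scale, ← hrdef]; field_simp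
  rw [hlogeq]
  set d : Fin K × Fin K → EuclideanSpace ℝ (Fin n ⊕ Fin n) := fun kl =>
    pairVec (meanDiff σ kl.1 kl.2) (meanDiff σ kl.1 kl.2) with hd
  -- Failure forces one of three events: a large projection `S g`, a large `g`, or a small inner
  -- product with some `S d_kl`. The diagonal pairs `k = l` have `d_kl = 0` and contribute empty
  -- events.
  have hsub : {g | ¬ ∃ tf : ℕ, StopsAt C η g tf ∧ (tf : ℝ) < 4 * Real.log (r ^ 30) / (η * γ) ∧
      RecoversFraction σ (iter C η g tf) (((K : ℝ) ^ 2 + 4 * K + 1) * r⁻¹)} ⊆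
      ({g | r ^ 2 ≤ ∑ v ∈ J, inner ℝ v (WithLp.toLp 2 g) ^ 2} ∪
        {g | 2 * n * r ^ 2 ≤ ‖(WithLp.toLp 2 g : EuclideanSpace ℝ (Fin n ⊕ Fin n))‖ ^ 2}) ∪
        ⋃ kl ∈ (Finset.univ : Finset (Fin K × Fin K)),
          {g | |inner ℝ (S (d kl)) (WithLp.toLp 2 g)| < r⁻¹ * ‖S (d kl)‖} := by
    intro g hg
    by_contra hcon
    simp only [Set.mem_union, Set.mem_iUnion, Set.mem_ofPred_eq, Finset.mem_univ, exists_prop,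
      true_and, not_or, not_exists, not_lt, not_le] at hcon
    obtain ⟨⟨e1, e2⟩, e3⟩ := hcon
    refine hg ?_
    rw [← hJ] at e1
    have hinit := fun (k l : Fin K) (hkl : k ≠ l) => init_bounds hS hSS C η hr0 e1.le e2.le
      (d := d (k, l)) (by
        have h1 := norm_pairVec_meanDiff_sq hσ hK1 hn hkl
        have h2 : (0 : ℝ) < 4 * K / n := by positivity
        rw [← h1] at h2
        exact lt_of_pow_lt_pow_left₀ 2 (norm_nonneg _) (by simpa using h2))
      ((hB1 _ (offDiag_blockProj_meanDiff hσ hK1 hn k l)).trans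
        (mul_le_mul_of_nonneg_right (hβ.trans hbr) (norm_nonneg _))) (e3 (k, l))
    obtain ⟨k₀, l₀, hkl₀⟩ : ∃ k l : Fin K, k ≠ l :=
      ⟨⟨0, by omega⟩, ⟨1, by omega⟩, by simp [Fin.ext_iff]⟩
    obtain ⟨i1, i2, -⟩ := hinit k₀ l₀ hkl₀
    obtain ⟨hB, hexit⟩ := hz _ i2
    have hKc : (1 : ℝ) ≤ (K : ℝ) ^ 2 + 4 * K + 1 := by
      have : 0 ≤ (K : ℝ) ^ 2 + 4 * K := by positivity
      linarith
    have hrinv : r⁻¹ ≤ 1 := inv_le_one_of_one_le₀ (by linarith)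
    obtain ⟨tf, htf, hst, hrec⟩ := stops_and_recovers hσ hK1 hn hη.le hγ.le hφ0
      (by positivity : 0 ≤ ν) (by positivity : 0 ≤ φ / γ) (inv_pos.2 hr0) hrinv hS hSS hSH hgS
      (hgN η hη.le (by nlinarith)) hB0
      (fun w hw => norm_gradErr_apply_le hn hD0 hdeg (by linarith) hw) (g := g) rfl
      (lt_of_lt_of_le (by positivity) i2) i1 (fun k l hkl => (hinit k l hkl).2.2) ht1
      (by rw [eps_eq_scale]; exact hA) hB (by rw [eps_eq_scale, Del_eq_scale]; exact hexit)
      (by rw [Del_eq_scale]; linarith [hpow 6 (by norm_num)])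
      (by
        rw [Del_eq_scale, ← hrdef]
        refine (add_le_add_left hβ _).trans ?_
        have h1 : b / r ^ 6 + 2 * (4 / r ^ 6) = (b + 8) / r ^ 6 := by ring
        rw [h1, inv_pow, ← one_div, div_div, div_le_div_iff₀ (by positivity) (by positivity)]
        have h2 : 32 * (b + 8) ≤ r ^ 3 := by linarith [hpow 3 (by norm_num)]
        have h3 : 0 < r ^ 3 := by positivity
        calc (b + 8) * (r ^ 3 * 32) = 32 * (b + 8) * r ^ 3 := by ring
          _ ≤ r ^ 3 * r ^ 3 := by gcongr
          _ = 1 * r ^ 6 := by ring)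
      (show r⁻¹ ^ 2 ≤ ((K : ℝ) ^ 2 + 4 * K + 1) * r⁻¹ by
        have h0 : 0 < r⁻¹ := inv_pos.2 hr0
        calc r⁻¹ ^ 2 = r⁻¹ * r⁻¹ := sq _
          _ ≤ ((K : ℝ) ^ 2 + 4 * K + 1) * r⁻¹ := by gcongr; linarith)
    exact ⟨tf, hst, lt_of_le_of_lt (by exact_mod_cast htf) htM, hrec⟩
  refine (measure_mono hsub).trans ((measure_union_le _ _).trans ?_)
  have p1 : gaussInit n {g | r ^ 2 ≤ ∑ v ∈ J, inner ℝ v (WithLp.toLp 2 g) ^ 2} ≤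
      ENNReal.ofReal (4 * K * r⁻¹) := by
    refine (gaussInit_sum_inner_sq_le J (fun v => v) hJ1 (by positivity)).trans
      (ENNReal.ofReal_le_ofReal ?_)
    rw [div_le_iff₀ (by positivity)]
    have h1 : (J.card : ℝ) ≤ 4 * K := by linarith
    calc (J.card : ℝ) ≤ 4 * K * 1 := by linarith
      _ ≤ 4 * K * r := by gcongr; linarith
      _ = 4 * K * r⁻¹ * r ^ 2 := by field_simp
  have p2 : gaussInit n {g | 2 * n * r ^ 2 ≤
      ‖(WithLp.toLp 2 g : EuclideanSpace ℝ (Fin n ⊕ Fin n))‖ ^ 2} ≤ ENNReal.ofReal r⁻¹ := by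
    refine (gaussInit_norm_sq_le (by positivity)).trans (ENNReal.ofReal_le_ofReal ?_)
    rw [div_le_iff₀ (by positivity)]
    calc 2 * (n : ℝ) = 2 * n * 1 := by ring
      _ ≤ 2 * n * r := by gcongr; linarith
      _ = r⁻¹ * (2 * n * r ^ 2) := by field_simp
  have p3 : gaussInit n (⋃ kl ∈ (Finset.univ : Finset (Fin K × Fin K)),
      {g | |inner ℝ (S (d kl)) (WithLp.toLp 2 g)| < r⁻¹ * ‖S (d kl)‖}) ≤
        ENNReal.ofReal ((K : ℝ) ^ 2 * r⁻¹) := by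
    refine (measure_biUnion_finset_le _ _).trans
      ((Finset.sum_le_sum fun kl _ => gaussInit_abs_inner_lt_le (S (d kl)) r⁻¹).trans ?_)
    rw [Finset.sum_const, nsmul_eq_mul, ENNReal.ofReal_mul (by positivity)]
    simp [sq, ENNReal.ofReal_mul]
  refine (add_le_add ((measure_union_le _ _).trans (add_le_add p1 p2)) p3).trans ?_
  rw [← ENNReal.ofReal_add (by positivity) (by positivity),
    ← ENNReal.ofReal_add (by positivity) (by positivity)]
  exact ENNReal.ofReal_le_ofReal (by linarith)

end Failure

end DeepWalk

end

/-! ### The error sequence and the assembly. -/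

theorem theorem3p8 (K T L : ℕ) (hK : 2 ≤ K) (hT : 1 ≤ T) (hTL : T < L)
    (ρ : ℝ) (hρ : ρ ∈ Set.Ioo (1 / 3 : ℝ) 1) (c : ℝ) (hc : 0 < c) (δ : ℝ) (hδ : 0 < δ)
    (ηmax : ℝ) (hηmax : 0 < ηmax) :
    ∃ err : ℕ → ℝ, Tendsto err atTop (𝓝 0) ∧
      ∀ (n : ℕ) (σ : Fin n → Fin K) (p q : unitInterval) (η : ℝ),
        1 ≤ n → DeepWalk.Balanced σ →
        (n : ℝ) ^ (ρ - 1) ≤ (q : ℝ) → (1 + δ) * (q : ℝ) ≤ p →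
        0 < η → η ≤ ηmax →
        ∀ᵐ e ∂(DeepWalk.sbm σ p q),
          DeepWalk.CoocError ρ c (DeepWalk.cooc T L (DeepWalk.adj (DeepWalk.graphOf e)))
              (DeepWalk.cooc T L (DeepWalk.expAdj σ p q)) →
          DeepWalk.gaussInit n
              {g | ¬ ∃ tf : ℕ,
                DeepWalk.StopsAt (DeepWalk.cooc T L (DeepWalk.adj (DeepWalk.graphOf e))) η g tf ∧
                (tf : ℝ) < 4 * Real.log (n / DeepWalk.Del n) /
                  (η * DeepWalk.gam n K T L p q) ∧
                DeepWalk.RecoversFraction σ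
                  (DeepWalk.iter (DeepWalk.cooc T L (DeepWalk.adj (DeepWalk.graphOf e))) η g tf)
                  (err n)} ≤ ENNReal.ofReal (err n) := by
  set κ := DeepWalk.windowMass T L with hκdef
  have hκ : 0 ≤ κ := DeepWalk.windowMass_nonneg hTL
  set g₀ : ℝ := δ / (K + δ) with hg₀
  have hg₀pos : 0 < g₀ := by positivity
  set b : ℝ := c / g₀ with hb
  set k : ℝ := (κ + c) / g₀ with hk
  set a : ℝ := ηmax * (T * L) with ha
  have hb0 : 0 ≤ b := by positivity
  have hk0 : 0 ≤ k := by positivity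
  have ha0 : 0 ≤ a := by positivity
  -- The terms `b`, `k`, `a` control the spectral perturbation, the degrees and the step size, all
  -- relative to `γ`.
  set R₀ : ℝ := 7680 * (b + k + a + 1) with hR₀
  -- Below the threshold the value `1` makes the probability bound trivial; only finitely many `n`
  -- are affected.
  refine ⟨fun n => if R₀ ≤ DeepWalk.scale n then ((K : ℝ) ^ 2 + 4 * K + 1) * (DeepWalk.scale n)⁻¹ else 1, ?_, ?_⟩
  · have h1 : Tendsto (fun n => ((K : ℝ) ^ 2 + 4 * K + 1) * (DeepWalk.scale n)⁻¹) atTop (𝓝 0) := by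
      simpa using (DeepWalk.tendsto_scale.inv_tendsto_atTop).const_mul ((K : ℝ) ^ 2 + 4 * K + 1)
    refine h1.congr' ?_
    filter_upwards [DeepWalk.tendsto_scale.eventually_ge_atTop R₀] with n hn
    rw [if_pos hn]
  intro n σ p q η hn hσ hq hpq hη hηle
  -- The argument works for every graph satisfying the norm bound, so the null set is empty.
  refine Filter.Eventually.of_forall fun e he => ?_
  by_cases hR : R₀ ≤ DeepWalk.scale n
  swap
  · simp only [if_neg hR, ENNReal.ofReal_one]
    exact prob_le_one
  simp only [if_pos hR]
  set r := DeepWalk.scale n with hr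
  have hn0 : (0 : ℝ) < n := by exact_mod_cast hn
  have hr1 : 7680 ≤ r := by linarith
  have hr0 : 0 < r := by linarith
  have hnr : (n : ℝ) = r ^ 36 := DeepWalk.natCast_eq_scale n
  have hq0 : 0 < (q : ℝ) := lt_of_lt_of_le (by positivity) hq
  have hK' : (2 : ℝ) ≤ K := by exact_mod_cast hK
  have hp0 : 0 ≤ (p : ℝ) := p.2.1
  have hden : 0 < (p : ℝ) + ((K : ℝ) - 1) * q :=
    add_pos_of_nonneg_of_pos hp0 (mul_pos (by linarith) hq0)
  obtain ⟨hγl, hγu⟩ := DeepWalk.gam_bounds (n := n) hK hT hTL hn hq0 hδ hpq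
  rw [← hg₀, hnr] at hγl
  rw [hnr] at hγu
  obtain ⟨-, hRn⟩ := he
  rw [DeepWalk.cooc_expAdj hσ T L (by omega) hn hden] at hRn
  have hφ := hRn.le.trans (DeepWalk.errorBound_le hρ.1 hc hn)
  set γ := DeepWalk.gam n K T L p q with hγ
  have hγ0 : 0 < γ := lt_of_lt_of_le (by positivity) hγl
  have hγl' : g₀ ≤ r ^ 36 * γ := by
    rw [div_le_iff₀ (by positivity)] at hγl; linarith
  have hγu' : r ^ 36 * γ ≤ T * L := by
    rw [le_div_iff₀ (by positivity)] at hγu; linarith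
  refine DeepWalk.failure_le hσ hK hn (k := k) (b := b) hκ hγ0 hη (by linarith) hb0 (by linarith) ?_
    (φ := c / r ^ 42) ?_ ?_ hφ
  · have h1 : η * (r ^ 36 * γ) ≤ a := by
      rw [ha]
      exact mul_le_mul hηle hγu' (by positivity) hηmax.le
    have h2 : r ≤ r ^ 36 := le_self_pow₀ (by linarith) (by norm_num)
    have h3 : 3 * (η * γ) * r ^ 36 ≤ 1 * r ^ 36 := by linarith
    exact le_of_mul_le_mul_right h3 (by positivity)
  · have h1 : c = b * g₀ := by rw [hb]; field_simp
    calc c / r ^ 42 = b / r ^ 42 * g₀ := by rw [h1]; ring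
      _ ≤ b / r ^ 42 * (r ^ 36 * γ) := by gcongr
      _ = b / r ^ 6 * γ := by field_simp
  · have h1 : κ + c = k * g₀ := by rw [hk]; field_simp
    have h2 : κ / n ≤ κ / r ^ 24 := by
      rw [hnr]
      exact div_le_div_of_nonneg_left hκ (by positivity)
        (pow_le_pow_right₀ (by linarith) (by norm_num))
    have h3 : c / r ^ 42 * √n = c / r ^ 24 := by
      rw [DeepWalk.sqrt_eq_scale, ← hr]; field_simp
    calc κ / n + c / r ^ 42 * √n ≤ κ / r ^ 24 + c / r ^ 24 := by rw [h3]; linarith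
      _ = k / r ^ 24 * g₀ := by rw [← add_div, h1]; ring
      _ ≤ k / r ^ 24 * (r ^ 36 * γ) := by gcongr
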